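/- **Setting.** Let $\langle\mathcal S,\mathcal A,P,r,\gamma\rangle$ be a discounted MDP with measurable state space $\mathcal S$, finite action space $\mathcal A$, probability kernel $P(ds'|s,a)$, bounded measurable reward $r$ and discount factor $\gamma\in(0,1)$. Policies are measurable maps $\pi:\mathcal S\to\mathcal A$; write $r_\pi(s)=r(s,\pi(s))$, $P_\pi(ds'|s)=P(ds'|s,\pi(s))$, $T_\pi f=r_\pi+\gamma P_\pi f$, $v_\pi=\sum_{t\ge0}\gamma^tP_\pi^t r_\pi$ for the value of $\pi$, and $v_*=\sup_\pi v_\pi$. All value functions $v_k$ below are bounded and measurable. For a function $e$, "$\pi=\widehat{\mathcal G}_{e}f$" means that $T_{\pi'}f\le T_\pi f+e$ pointwise for every policy $\pi'$. *AMPI* with parameter $m\in\{1,2,\dots\}\cup\{\infty\}$: from an arbitrary $v_0$, for all $k\ge1$, $$\pi_k=\widehat{\mathcal G}_{\epsilon'_k}v_{k-1},\qquad v_k=(T_{\pi_k})^m v_{k-1}+\epsilon_k ,$$ where $(T_\pi)^\infty f:=v_\pi$. *CBMPI* with parameter $m\in\{1,2,\dots\}$: from an arbitrary $v_0$ and an initial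 policy $\pi_1=\widehat{\mathcal G}_{\epsilon'_1}v_0$, for all $k\ge1$, $$v_k=(T_{\pi_k})^m v_{k-1}+\epsilon_k,\qquad \pi_{k+1}=\widehat{\mathcal G}_{\epsilon'_{k+1}}\big[(T_{\pi_k})^m v_{k-1}\big].$$ The functions $\epsilon_k$ and $\epsilon'_k$ (evaluation and greedy step errors) are measurable. The loss is $l_k=v_*-v_{\pi_k}$; put $d_0=v_*-v_0$ and $b_0=v_0-T_{\pi_1}v_0$. Let $\rho,\mu$ be probability distributions on $\mathcal S$ such that $\rho P_{\pi_1}\cdots P_{\pi_j}$ has a density with respect to $\mu$ for all $j\ge0$ and all policies $\pi_1,\dots,\pi_j$. Let $1\le p<\infty$ and $q,q'\in[1,\infty]$ with $\frac1q+\frac1{q'}=1$. Define $$c_q(j)=\sup_{\pi_1,\dots,\pi_j}\Big\|\frac{d(\rho P_{\pi_1}\cdots P_{\pi_j})}{d\mu}\Big\|_{q,\mu},\qquad \mathcal C_q^{l,k,d}=\frac{(1-\gamma)^2}{\gamma^l-\gamma^k}\sum_{i=l}^{k-1}\sum_{j=i}^{\infty}\gamma^j c_q(j+d)\quad(l<k),$$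 $$g(k)=\frac{2\gamma^k}{1-\gamma}\big(\mathcal C_q^{k,k+1,0}\big)^{1/p}\min\big(\|d_0\|_{pq',\mu},\|b_0\|_{pq',\mu}\big),$$ all as elements of $[0,\infty]$ with $0\cdot\infty=0$. **Theorem.** For every $k\ge1$, after $k$ iterations the loss of AMPI satisfies $$\|l_k\|_{p,\rho}\le 2\sum_{i=1}^{k-1}\frac{\gamma^i}{1-\gamma}\big(\mathcal C_q^{i,i+1,0}\big)^{1/p}\|\epsilon_{k-i}\|_{pq',\mu}+\sum_{i=0}^{k-1}\frac{\gamma^i}{1-\gamma}\big(\mathcal C_q^{i,i+1,0}\big)^{1/p}\|\epsilon'_{k-i}\|_{pq',\mu}+g(k),$$ while the loss of CBMPI satisfies $$\|l_k\|_{p,\rho}\le 2\gamma^m\sum_{i=1}^{k-2}\frac{\gamma^i}{1-\gamma}\big(\mathcal C_q^{i,i+1,m}\big)^{1/p}\|\epsilon_{k-i-1}\|_{pq',\mu}+\sum_{i=0}^{k-1}\frac{\gamma^i}{1-\gamma}\big(\mathcal C_q^{i,i+1,0}\big)^{1/p}\|\epsilon'_{k-i}\|_{pq',\mu}+g(k).$$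 -/

import Mathlib

open MeasureTheory ProbabilityTheory
open scoped ENNReal NNReal

noncomputable section

/-- A discounted Markov decision process with state space `S` and action space `A`: transition
kernel `P (s, a) (ds')`, bounded measurable reward `r` and discount factor `γ ∈ (0, 1)`. -/
structure MDP (S A : Type*) [MeasurableSpace S] [MeasurableSpace A] where
  P : Kernel (S × A) S
  isMarkov : IsMarkovKernel P
  r : S × A → ℝ
  measurable_r : Measurable r
  bounded_r : ∃ R : ℝ, ∀ x, |r x| ≤ R
  γ : ℝ
  γ_pos : 0 < γ
  γ_lt_one : γ < 1

namespace MDP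

variable {S A : Type*} [MeasurableSpace S] [MeasurableSpace A]

/-- Deterministic stationary (measurable) policies. -/
def Policy (_M : MDP S A) : Type _ := {π : S → A // Measurable π}

variable (M : MDP S A)

/-- The reward function `r_π(s) = r(s, π(s))`. -/
def reward (π : M.Policy) (s : S) : ℝ := M.r (s, π.1 s)

/-- The kernel `P_π(ds' | s) = P(ds' | s, π(s))`. -/
def trans (π : M.Policy) : Kernel S S :=
  M.P.comap (fun s => (s, π.1 s)) (measurable_id.prodMk π.2)

/-- The distribution `ν P_{π 0} P_{π 1} ⋯ P_{π (j - 1)}` of the state after `j` transitions, when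
the initial state has law `ν` and the policies `π 0, π 1, …` are followed successively. -/
def stateLaw (ν : Measure S) (π : ℕ → M.Policy) : ℕ → Measure S
  | 0 => ν
  | j + 1 => (stateLaw ν π j).bind (M.trans (π j))

/-- The value `v_π(s) = ∑ₜ γ^t 𝔼[r_π(s_t) | s_0 = s]` of a policy, where `s_{t+1} ∼ P_π(· | s_t)`. -/
def value (π : M.Policy) (s : S) : ℝ :=
  ∑' t : ℕ, M.γ ^ t * ∫ y, M.reward π y ∂(M.stateLaw (Measure.dirac s) (fun _ => π) t)

/-- The optimal value function `v_*`. -/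
def optValue (s : S) : ℝ := ⨆ π : M.Policy, M.value π s

/-- The Bellman operator `T_π f = r_π + γ P_π f`. -/
def bellman (π : M.Policy) (f : S → ℝ) (s : S) : ℝ :=
  M.reward π s + M.γ * ∫ y, f y ∂(M.trans π s)

/-- The operator `(T_π)^m` for `m ∈ ℕ ∪ {∞}`, where `(T_π)^∞ f = v_π`. -/
def bellmanPow (π : M.Policy) : ℕ∞ → (S → ℝ) → S → ℝ
  | (m : ℕ) => (M.bellman π)^[m]
  | ⊤ => fun _ => M.value π

/-- `π` is greedy with respect to `f` up to the error `e`: `T_{π'} f ≤ T_π f + e` for every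
policy `π'`. -/
def ApproxGreedy (f e : S → ℝ) (π : M.Policy) : Prop :=
  ∀ (π' : M.Policy) (s : S), M.bellman π' f s ≤ M.bellman π f s + e s

/-- A run of AMPI with parameter `m`: value functions `v k` (`k ≥ 0`), policies `π k` (`k ≥ 1`),
evaluation step errors `ε k` and greedy step errors `ε' k` (`k ≥ 1`). The entries `π 0`, `ε 0`,
`ε' 0` play no role. -/
structure IsAMPI (m : ℕ∞) (v : ℕ → S → ℝ) (π : ℕ → M.Policy) (ε ε' : ℕ → S → ℝ) : Prop where
  measurable_v : ∀ k, Measurable (v k)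
  bounded_v : ∀ k, ∃ B : ℝ, ∀ s, |v k s| ≤ B
  measurable_greedyError : ∀ k, Measurable (ε' k)
  greedy : ∀ k, M.ApproxGreedy (v k) (ε' (k + 1)) (π (k + 1))
  eval : ∀ k s, v (k + 1) s = M.bellmanPow (π (k + 1)) m (v k) s + ε (k + 1) s

/-- A run of CBMPI with parameter `m`: here the policy `π (k + 1)` is approximately greedy with
respect to `w_k = (T_{π_k})^m v_{k-1}` and not with respect to `v k = w_k + ε k`. The greedy step
error of the initial policy `π 1` is measured with respect to the initial value `v 0`. -/
structure IsCBMPI (m : ℕ) (v : ℕ → S → ℝ) (π : ℕ → M.Policy) (ε ε' : ℕ → S → ℝ) : Prop where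
  measurable_v : ∀ k, Measurable (v k)
  bounded_v : ∀ k, ∃ B : ℝ, ∀ s, |v k s| ≤ B
  measurable_greedyError : ∀ k, Measurable (ε' k)
  greedy_one : M.ApproxGreedy (v 0) (ε' 1) (π 1)
  greedy : ∀ k, M.ApproxGreedy (M.bellmanPow (π (k + 1)) m (v k)) (ε' (k + 2)) (π (k + 2))
  eval : ∀ k s, v (k + 1) s = M.bellmanPow (π (k + 1)) m (v k) s + ε (k + 1) s

/-- The loss `l = v_* - v_π` of a policy. -/
def loss (π : M.Policy) (s : S) : ℝ := M.optValue s - M.value π s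

/-- `c_q(j) = sup ‖d(ρ P_{π_1} ⋯ P_{π_j}) / dμ‖_{q, μ}` over all policies `π_1, …, π_j`
(a meaningful quantity when all these distributions have densities with respect to `μ`). -/
def concCoeff (ρ μ : Measure S) (q : ℝ≥0∞) (j : ℕ) : ℝ≥0∞ :=
  ⨆ π : ℕ → M.Policy, eLpNorm ((M.stateLaw ρ π j).rnDeriv μ) q μ

/-- `C_q^{l,k,d} = (1 - γ)² / (γ^l - γ^k) * ∑_{i=l}^{k-1} ∑_{j=i}^∞ γ^j c_q(j + d)`, for `l < k`. -/
def concentrability (ρ μ : Measure S) (q : ℝ≥0∞) (l k d : ℕ) : ℝ≥0∞ :=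
  ENNReal.ofReal ((1 - M.γ) ^ 2 / (M.γ ^ l - M.γ ^ k)) *
    ∑ i ∈ Finset.Ico l k, ∑' n : ℕ,
      ENNReal.ofReal (M.γ ^ (i + n)) * M.concCoeff ρ μ q (i + n + d)

/-- The weight `γ^i / (1 - γ) * (C_q^{i,i+1,d})^{1/p}`. -/
def weight (ρ μ : Measure S) (p : ℝ≥0) (q : ℝ≥0∞) (i d : ℕ) : ℝ≥0∞ :=
  ENNReal.ofReal (M.γ ^ i / (1 - M.γ)) * M.concentrability ρ μ q i (i + 1) d ^ (1 / (p : ℝ))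

/-- `g(k) = 2 γ^k / (1 - γ) * (C_q^{k,k+1,0})^{1/p} * min (‖d_0‖_{pq',μ}) (‖b_0‖_{pq',μ})`, where
`d_0 = v_* - v_0` and `b_0 = v_0 - T_{π_1} v_0`. -/
def initTerm (ρ μ : Measure S) (p : ℝ≥0) (q q' : ℝ≥0∞) (v₀ : S → ℝ) (π₁ : M.Policy) (k : ℕ) :
    ℝ≥0∞ :=
  2 * M.weight ρ μ p q k 0 *
    min (eLpNorm (fun s => M.optValue s - v₀ s) (p * q') μ)
      (eLpNorm (fun s => v₀ s - M.bellman π₁ v₀ s) (p * q') μ)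

end MDP

end

/-!
All errors are propagated as functions with values in `[0, ∞]`, through the single sublinear operator
`R f = γ sup_a ∫ f dP(· | s, a)` (`MDP.discExp`), which dominates `γ P_π` for every policy `π`. So
products `γ^j P_{π_1} ⋯ P_{π_j}` never have to be tracked: they are all replaced by `R^j`, and since
the action space is finite, measurable selection shows that nothing is lost
(`MDP.exists_lintegral_iterate_maxExp_eq`).

*Pointwise bound.* The positive part `(f - g)⁺` obeys the triangle inequality, and
`(T_π f - T_π g)⁺ ≤ R (f - g)⁺`. Let `w_k = (T_{π_k})^m v_{k-1}`, `w_0 = v_0`, and put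
`D_k = (v_* - w_k)⁺`, `B_k = (v_k - T_{π_{k+1}} v_k)⁺`. Writing `v_* = v_{π_*}`, one finds
`D_{k+1} ≤ R D_k + Y_k + ∑_{1 ≤ j < m} R^j B_k` and
`B_{k+1} ≤ R^m B_k + |ε_{k+1}| + R |ε_{k+1}| + ε'_{k+2}` with `Y_k = R |ε_k| + ε'_{k+1}`, while the
loss of `π_{k+1}` is at most `R D_k + Y_k + ∑_{j ≥ 1} R^j B_k`. The two parts of the Neumann series
of `B_k` fit together, so that the quantity `R^n Y_k + R^{n+1} D_k + ∑_{j > n} R^j B_k` at `k + 1` is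
bounded by the same quantity at `k`, with `n` raised by one, plus
`2 ∑_{j > n} R^j |ε_{k+1}| + ∑_{j ≥ n} R^j ε'_{k+2}` (`MDP.propagation_step`). This recursion is
solved by `MDP.propagation`. The starting quantity is bounded in terms of `|v_* - v_0|` or of
`|v_0 - T_{π_1} v_0|` (`MDP.initial_le_of_dist`, `MDP.initial_le_of_residual`), which gives
`MDP.IsAMPI.excess_le`, for finite and infinite `m` alike.

*Norms.* The tail `∑_{j ≥ i} R^j f` is `γ^i / (1 - γ)` times an average with weights
`(1 - γ) γ^n`. By Jensen's inequality its `p`-th power integrates to at most an average of the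
integrals of `f ^ p` against laws `ρ P_{π_1} ⋯ P_{π_j}`, and Hölder's inequality against the
densities produces the concentrability coefficients (`MDP.eLpNorm_discTail_iterate_le`).
Minkowski's inequality then gives the bound for AMPI.

*CBMPI.* The functions `w_k` form a run of AMPI with the same policies, whose evaluation error at
step `k` is `(T_{π_k})^m v_{k-1} - (T_{π_k})^m w_{k-1}`, at most `R^m |ε_{k-1}|`, and zero for `k = 1`
(`MDP.IsCBMPI.isAMPI_exactValue`). The factor `R^m` accounts for `γ^m` and for the shift by `m` in
the coefficients.
-/

noncomputable section

/-! ### Bounded measurable functions and measurable selection -/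

/-- Bounded measurable real functions, the domain on which the Bellman operators act. -/
structure BoundedMeasurable {S : Type*} [MeasurableSpace S] (f : S → ℝ) : Prop where
  measurable : Measurable f
  bounded : ∃ B : ℝ, ∀ s, |f s| ≤ B

namespace BoundedMeasurable

variable {S : Type*} [MeasurableSpace S] {f g : S → ℝ}

theorem const (c : ℝ) : BoundedMeasurable (fun _ : S => c) :=
  ⟨measurable_const, |c|, fun _ => le_rfl⟩

theorem sub (hf : BoundedMeasurable f) (hg : BoundedMeasurable g) :
    BoundedMeasurable (fun s => f s - g s) := by
  obtain ⟨B, hB⟩ := hf.bounded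
  obtain ⟨C, hC⟩ := hg.bounded
  exact ⟨hf.measurable.sub hg.measurable, B + C, fun s =>
    (abs_sub (f s) (g s)).trans (add_le_add (hB s) (hC s))⟩

theorem integrable (hf : BoundedMeasurable f) (ν : Measure S) [IsFiniteMeasure ν] :
    Integrable f ν := by
  obtain ⟨B, hB⟩ := hf.bounded
  exact Integrable.of_bound hf.measurable.aestronglyMeasurable B (Filter.Eventually.of_forall hB)

end BoundedMeasurable

/-- A finite family of measurable functions has a measurable pointwise maximizer. -/
theorem exists_measurable_argmax {S A β : Type*} [MeasurableSpace S] [MeasurableSpace A]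
    [Finite A] [Nonempty A] [DiscreteMeasurableSpace A] [LinearOrder β] [TopologicalSpace β]
    [OrderClosedTopology β] [SecondCountableTopology β] [MeasurableSpace β]
    [OpensMeasurableSpace β]
    (f : S → A → β) (hf : ∀ a, Measurable (fun s => f s a)) :
    ∃ π : S → A, Measurable π ∧ ∀ s a, f s a ≤ f s (π s) := by
  classical
  cases nonempty_fintype A
  have hf' : Measurable (fun x : S × A => f x.1 x.2) :=
    measurable_from_prod_countable_left hf
  suffices h : ∀ t : Finset A, ∃ π : S → A, Measurable π ∧ ∀ s, ∀ a ∈ t, f s a ≤ f s (π s) by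
    obtain ⟨π, hπ, h⟩ := h Finset.univ
    exact ⟨π, hπ, fun s a => h s a (Finset.mem_univ a)⟩
  intro t
  induction t using Finset.induction_on with
  | empty => exact ⟨fun _ => Classical.arbitrary A, measurable_const, by simp⟩
  | insert b t _ ih =>
    obtain ⟨π, hπ, h⟩ := ih
    refine ⟨fun s => if f s (π s) ≤ f s b then b else π s, ?_, fun s a ha => ?_⟩
    · exact Measurable.ite (measurableSet_le (hf'.comp (measurable_id.prodMk hπ)) (hf b))
        measurable_const hπ
    · dsimp only
      rcases Finset.mem_insert.1 ha with rfl | ha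
      · split_ifs with hc
        · exact le_rfl
        · exact (not_le.1 hc).le
      · split_ifs with hc
        · exact (h s a ha).trans hc
        · exact h s a ha

/-- The integral is at most the Lebesgue integral of the positive part. -/
theorem ofReal_integral_le_lintegral_ofReal {S : Type*} [MeasurableSpace S] (ν : Measure S)
    (f : S → ℝ) : ENNReal.ofReal (∫ y, f y ∂ν) ≤ ∫⁻ y, ENNReal.ofReal (f y) ∂ν := by
  by_cases hf : Integrable f ν
  · rw [integral_eq_lintegral_pos_part_sub_lintegral_neg_part hf]
    refine (ENNReal.ofReal_le_ofReal (sub_le_self _ ENNReal.toReal_nonneg)).trans ?_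
    exact ENNReal.ofReal_toReal_le
  · simp [integral_undef hf]

namespace MDP

variable {S A : Type*} [MeasurableSpace S] [MeasurableSpace A] (M : MDP S A)

instance : IsMarkovKernel M.P := M.isMarkov

instance (π : M.Policy) : IsMarkovKernel (M.trans π) := by
  unfold trans; infer_instance

theorem trans_apply (π : M.Policy) (s : S) : M.trans π s = M.P (s, π.1 s) := by
  simp [trans, Kernel.comap_apply]

theorem γ_nonneg : 0 ≤ M.γ := M.γ_pos.le

theorem boundedMeasurable_reward (π : M.Policy) : BoundedMeasurable (M.reward π) := by
  obtain ⟨R, hR⟩ := M.bounded_r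
  exact ⟨M.measurable_r.comp (measurable_id.prodMk π.2), R, fun s => hR _⟩

/-! ### The maximal expectation operator -/

/-- The largest expected value `sup_a ∫ f dP(· | s, a)` of `f` after one transition. -/
def maxExp (f : S → ℝ≥0∞) (s : S) : ℝ≥0∞ := ⨆ a, ∫⁻ y, f y ∂M.P (s, a)

/-- The discounted operator `f ↦ γ sup_a ∫ f dP(· | s, a)`. It dominates `γ P_π` for every
policy `π`, so that products `γ^j P_{π_1} ⋯ P_{π_j}` are dominated by its `j`-th iterate. -/
def discExp (f : S → ℝ≥0∞) (s : S) : ℝ≥0∞ := ENNReal.ofReal M.γ * M.maxExp f s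

/-- The tail `∑_{j ≥ n} (γ sup_a P)^j f` of the Neumann series of `MDP.discExp`. -/
def discTail (n : ℕ) (f : S → ℝ≥0∞) (s : S) : ℝ≥0∞ := ∑' i : ℕ, M.discExp^[n + i] f s

variable {M} {f g : S → ℝ≥0∞}

theorem maxExp_mono (h : ∀ s, f s ≤ g s) (s : S) : M.maxExp f s ≤ M.maxExp g s :=
  iSup_mono fun _ => lintegral_mono h

theorem discExp_mono (h : ∀ s, f s ≤ g s) (s : S) : M.discExp f s ≤ M.discExp g s :=
  mul_le_mul_right (maxExp_mono h s) _

theorem iterate_discExp_mono (h : ∀ s, f s ≤ g s) (n : ℕ) (s : S) :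
    M.discExp^[n] f s ≤ M.discExp^[n] g s := by
  induction n generalizing s with
  | zero => exact h s
  | succ n ih => simpa only [Function.iterate_succ_apply'] using discExp_mono ih s

theorem discTail_mono (h : ∀ s, f s ≤ g s) (n : ℕ) (s : S) :
    M.discTail n f s ≤ M.discTail n g s :=
  ENNReal.tsum_le_tsum fun _ => iterate_discExp_mono h _ s

theorem discExp_zero (s : S) : M.discExp (fun _ => 0) s = 0 := by simp [discExp, maxExp]

theorem iterate_discExp_zero (n : ℕ) : M.discExp^[n] (fun _ => 0) = fun _ => 0 :=
  Function.iterate_fixed (funext discExp_zero) n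

theorem discTail_eq_add (n : ℕ) (f : S → ℝ≥0∞) (s : S) :
    M.discTail n f s = M.discExp^[n] f s + M.discTail (n + 1) f s := by
  rw [discTail, tsum_eq_zero_add' ENNReal.summable]
  simp only [discTail, add_zero]
  congr 2 with i
  rw [Nat.add_right_comm, Nat.add_assoc]

theorem discTail_iterate_discExp (n m : ℕ) (f : S → ℝ≥0∞) (s : S) :
    M.discTail n (M.discExp^[m] f) s = M.discTail (n + m) f s := by
  simp only [discTail]
  congr 1 with i
  rw [← Function.iterate_add_apply, Nat.add_right_comm]

theorem discExp_tsum_le {F : ℕ → S → ℝ≥0∞} (hF : ∀ i, Measurable (F i)) (s : S) :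
    M.discExp (fun x => ∑' i, F i x) s ≤ ∑' i, M.discExp (F i) s := by
  simp only [discExp, ENNReal.tsum_mul_left]
  refine mul_le_mul_right (iSup_le fun a => ?_) _
  rw [lintegral_tsum fun i => (hF i).aemeasurable]
  exact ENNReal.tsum_le_tsum fun i => le_iSup (fun a => ∫⁻ y, F i y ∂M.P (s, a)) a

theorem discExp_add_le (hf : Measurable f) (s : S) :
    M.discExp (fun x => f x + g x) s ≤ M.discExp f s + M.discExp g s := by
  simp only [discExp, ← mul_add]
  refine mul_le_mul_right (iSup_le fun a => ?_) _
  rw [lintegral_add_left hf]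
  exact add_le_add (le_iSup (fun a => ∫⁻ y, f y ∂M.P (s, a)) a)
    (le_iSup (fun a => ∫⁻ y, g y ∂M.P (s, a)) a)

variable [Countable A]

theorem measurable_maxExp (hf : Measurable f) : Measurable (M.maxExp f) :=
  Measurable.iSup fun _ => hf.lintegral_kernel.comp measurable_prodMk_right

theorem measurable_discExp (hf : Measurable f) : Measurable (M.discExp f) :=
  (measurable_maxExp hf).const_mul _

theorem measurable_iterate_discExp (hf : Measurable f) (n : ℕ) :
    Measurable (M.discExp^[n] f) := by
  induction n with
  | zero => exact hf
  | succ n ih => simpa only [Function.iterate_succ_apply'] using measurable_discExp ih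

theorem measurable_discTail (hf : Measurable f) (n : ℕ) : Measurable (M.discTail n f) :=
  Measurable.tsum fun _ => measurable_iterate_discExp hf _

theorem iterate_discExp_tsum_le {F : ℕ → S → ℝ≥0∞} (hF : ∀ i, Measurable (F i)) (n : ℕ) (s : S) :
    M.discExp^[n] (fun x => ∑' i, F i x) s ≤ ∑' i, M.discExp^[n] (F i) s := by
  induction n generalizing s with
  | zero => exact le_rfl
  | succ n ih =>
    simp only [Function.iterate_succ_apply']
    exact (discExp_mono ih s).trans
      (discExp_tsum_le (fun i => measurable_iterate_discExp (hF i) n) s)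

theorem iterate_discExp_add_le (hf : Measurable f) (n : ℕ) (s : S) :
    M.discExp^[n] (fun x => f x + g x) s ≤ M.discExp^[n] f s + M.discExp^[n] g s := by
  induction n generalizing s with
  | zero => exact le_rfl
  | succ n ih =>
    simp only [Function.iterate_succ_apply']
    exact (discExp_mono ih s).trans (discExp_add_le (measurable_iterate_discExp hf n) s)

theorem discTail_add_le (hf : Measurable f) (n : ℕ) (s : S) :
    M.discTail n (fun x => f x + g x) s ≤ M.discTail n f s + M.discTail n g s := by
  simp only [discTail, ← ENNReal.tsum_add]
  exact ENNReal.tsum_le_tsum fun i => iterate_discExp_add_le hf _ s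

theorem iterate_discExp_discTail_le (hf : Measurable f) (n m : ℕ) (s : S) :
    M.discExp^[n] (M.discTail m f) s ≤ M.discTail (n + m) f s := by
  refine (iterate_discExp_tsum_le (fun i => measurable_iterate_discExp hf (m + i)) n s).trans ?_
  simp only [← Function.iterate_add_apply, discTail, add_assoc, le_refl]

end MDP

/-! ### Bellman operators -/

theorem abs_integral_le_of_abs_le {S : Type*} [MeasurableSpace S] (ν : Measure S)
    [IsProbabilityMeasure ν] {f : S → ℝ} {C : ℝ} (h : ∀ s, |f s| ≤ C) : |∫ y, f y ∂ν| ≤ C := by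
  have h' : ∀ s, ‖f s‖ ≤ C := h
  simpa using norm_integral_le_of_norm_le_const (μ := ν) (Filter.Eventually.of_forall h')

/-- A contraction of the bounded measurable functions for the supremum norm has a fixed point. -/
theorem exists_fixedPoint_of_contraction {S : Type*} [MeasurableSpace S]
    (Φ : (S → ℝ) → S → ℝ) {c : ℝ} (hc₀ : 0 ≤ c) (hc : c < 1)
    (hΦ : ∀ f, BoundedMeasurable f → BoundedMeasurable (Φ f))
    (hΦc : ∀ f g, BoundedMeasurable f → BoundedMeasurable g → ∀ C, (∀ s, |f s - g s| ≤ C) →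
      ∀ s, |Φ f s - Φ g s| ≤ c * C) :
    ∃ u, BoundedMeasurable u ∧ Φ u = u := by
  set x : ℕ → S → ℝ := fun n => Φ^[n] (fun _ => 0) with hx
  have hsucc : ∀ n, x (n + 1) = Φ (x n) := fun n => Function.iterate_succ_apply' _ _ _
  have hbm : ∀ n, BoundedMeasurable (x n) := fun n => by
    induction n with
    | zero => exact BoundedMeasurable.const 0
    | succ n ih => exact hsucc n ▸ hΦ _ ih
  obtain ⟨C, hC⟩ := ((hbm 0).sub (hbm 1)).bounded
  have hdist : ∀ n s, |x n s - x (n + 1) s| ≤ C * c ^ n := fun n => by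
    induction n with
    | zero => simpa using hC
    | succ n ih =>
      intro s
      have := hΦc _ _ (hbm n) (hbm (n + 1)) _ ih s
      rw [← hsucc, ← hsucc] at this
      exact this.trans_eq (by ring)
  have hlim : ∀ s, ∃ l, Filter.Tendsto (fun n => x n s) Filter.atTop (nhds l) := fun s =>
    cauchySeq_tendsto_of_complete
      (cauchySeq_of_le_geometric c C hc fun n => (Real.dist_eq _ _).trans_le (hdist n s))
  choose u hu using hlim
  have hxu : ∀ n s, |x n s - u s| ≤ C * c ^ n / (1 - c) := fun n s =>
    dist_le_of_le_geometric_of_tendsto c C hc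
      (fun n => (Real.dist_eq _ _).trans_le (hdist n s)) (hu s) n
  have hubm : BoundedMeasurable u := by
    refine ⟨measurable_of_tendsto_metrizable (fun n => (hbm n).measurable)
      (tendsto_pi_nhds.2 hu), C / (1 - c), fun s => ?_⟩
    simpa [hx] using hxu 0 s
  refine ⟨u, hubm, funext fun s => ?_⟩
  -- Both `Φ u s` and `u s` are limits of `x (n + 1) s`.
  have hc0 : Filter.Tendsto (fun n => c * (C * c ^ n / (1 - c))) Filter.atTop (nhds 0) := by
    simpa using (((tendsto_pow_atTop_nhds_zero_of_lt_one hc₀ hc).const_mul C).div_const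
      (1 - c)).const_mul c
  have hΦu : Filter.Tendsto (fun n => x (n + 1) s) Filter.atTop (nhds (Φ u s)) := by
    rw [tendsto_iff_dist_tendsto_zero]
    refine squeeze_zero (fun _ => dist_nonneg) (fun n => ?_) hc0
    rw [hsucc, Real.dist_eq]
    exact hΦc _ _ (hbm n) hubm _ (hxu n) s
  exact tendsto_nhds_unique hΦu ((hu s).comp (Filter.tendsto_add_atTop_nat 1))

/-- The positive part `(f - g)⁺`, as a function with values in `[0, ∞]`. As a function of the
pair `(f, g)` it satisfies the triangle inequality. -/
def excess {S : Type*} (f g : S → ℝ) (s : S) : ℝ≥0∞ := ENNReal.ofReal (f s - g s)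

section excess

variable {S : Type*} {f g h : S → ℝ}

theorem excess_triangle (f g h : S → ℝ) (s : S) : excess f h s ≤ excess f g s + excess g h s := by
  rw [excess, ← sub_add_sub_cancel (f s) (g s) (h s)]
  exact ENNReal.ofReal_add_le

theorem excess_le_enorm (s : S) : excess f g s ≤ ‖f s - g s‖ₑ :=
  by
  rw [excess, Real.enorm_eq_ofReal_abs]
  exact ENNReal.ofReal_le_ofReal (le_abs_self _)

theorem excess_le_enorm_swap (s : S) : excess f g s ≤ ‖g s - f s‖ₑ := by
  rw [← enorm_neg (g s - f s), neg_sub]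
  exact excess_le_enorm s

theorem measurable_excess [MeasurableSpace S] (hf : Measurable f) (hg : Measurable g) :
    Measurable (excess f g) :=
  ENNReal.measurable_ofReal.comp (hf.sub hg)

end excess

/-- Telescoping along a convergent sequence, for positive parts. -/
theorem ofReal_sub_le_tsum {x : ℕ → ℝ} {y : ℝ} {c : ℕ → ℝ≥0∞}
    (hx : Filter.Tendsto x Filter.atTop (nhds y))
    (hc : ∀ i, ENNReal.ofReal (x i - x (i + 1)) ≤ c i) :
    ENNReal.ofReal (x 0 - y) ≤ ∑' i, c i := by
  have h : ∀ n, ENNReal.ofReal (x 0 - x n) ≤ ∑' i, c i := fun n => by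
    refine le_trans ?_ (ENNReal.sum_le_tsum (Finset.range n))
    rw [← Finset.sum_range_sub']
    refine (Finset.le_sum_of_subadditive _ ENNReal.ofReal_zero.le ?_ _ _).trans
      (Finset.sum_le_sum fun i _ => hc i)
    exact fun _ _ => ENNReal.ofReal_add_le
  exact le_of_tendsto' ((ENNReal.continuous_ofReal.tendsto _).comp (hx.const_sub (x 0))) h

namespace MDP

variable {S A : Type*} [MeasurableSpace S] [MeasurableSpace A] {M : MDP S A} {π : M.Policy}
  {f g : S → ℝ}

theorem boundedMeasurable_bellman (π : M.Policy) (hf : BoundedMeasurable f) :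
    BoundedMeasurable (M.bellman π f) := by
  obtain ⟨R, hR⟩ := (M.boundedMeasurable_reward π).bounded
  obtain ⟨B, hB⟩ := hf.bounded
  refine ⟨(M.boundedMeasurable_reward π).measurable.add
    ((hf.measurable.stronglyMeasurable.integral_kernel (κ := M.trans π)).measurable.const_mul _),
    R + M.γ * B, fun s => (abs_add_le _ _).trans (add_le_add (hR s) ?_)⟩
  rw [abs_mul, abs_of_pos M.γ_pos]
  gcongr
  · exact M.γ_nonneg
  · exact abs_integral_le_of_abs_le (M.trans π s) hB

theorem boundedMeasurable_iterate_bellman (π : M.Policy) (hf : BoundedMeasurable f) (n : ℕ) :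
    BoundedMeasurable ((M.bellman π)^[n] f) := by
  induction n with
  | zero => exact hf
  | succ n ih => simpa only [Function.iterate_succ_apply'] using boundedMeasurable_bellman π ih

theorem bellman_sub_bellman (hf : BoundedMeasurable f) (hg : BoundedMeasurable g) (s : S) :
    M.bellman π f s - M.bellman π g s = M.γ * ∫ y, (f y - g y) ∂M.trans π s := by
  rw [integral_sub (hf.integrable _) (hg.integrable _), bellman, bellman]
  ring

theorem abs_bellman_sub_le (hf : BoundedMeasurable f) (hg : BoundedMeasurable g) {C : ℝ}
    (h : ∀ s, |f s - g s| ≤ C) (s : S) : |M.bellman π f s - M.bellman π g s| ≤ M.γ * C := by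
  rw [bellman_sub_bellman hf hg, abs_mul, abs_of_pos M.γ_pos]
  gcongr
  · exact M.γ_nonneg
  · exact abs_integral_le_of_abs_le (M.trans π s) h

theorem excess_bellman_le (hf : BoundedMeasurable f) (hg : BoundedMeasurable g) (s : S) :
    excess (M.bellman π f) (M.bellman π g) s ≤ M.discExp (excess f g) s := by
  rw [excess, bellman_sub_bellman hf hg, ENNReal.ofReal_mul M.γ_nonneg, discExp]
  refine mul_le_mul_right ((ofReal_integral_le_lintegral_ofReal _ _).trans ?_) _
  rw [trans_apply]
  exact le_iSup (fun a => ∫⁻ y, excess f g y ∂M.P (s, a)) (π.1 s)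

theorem excess_iterate_bellman_le (hf : BoundedMeasurable f) (hg : BoundedMeasurable g) (n : ℕ)
    (s : S) : excess ((M.bellman π)^[n] f) ((M.bellman π)^[n] g) s ≤
      M.discExp^[n] (excess f g) s := by
  induction n generalizing s with
  | zero => exact le_rfl
  | succ n ih =>
    simp only [Function.iterate_succ_apply']
    exact (excess_bellman_le (boundedMeasurable_iterate_bellman π hf n)
      (boundedMeasurable_iterate_bellman π hg n) s).trans (discExp_mono ih s)

theorem enorm_iterate_bellman_sub_le {π : M.Policy} {f g : S → ℝ} (hf : BoundedMeasurable f)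
    (hg : BoundedMeasurable g) (n : ℕ) (s : S) :
    ‖(M.bellman π)^[n] f s - (M.bellman π)^[n] g s‖ₑ ≤
      M.discExp^[n] (fun x => ‖f x - g x‖ₑ) s := by
  have h1 := (excess_iterate_bellman_le (π := π) hf hg n s).trans
    (iterate_discExp_mono (fun x => excess_le_enorm x) n s)
  have h2 := (excess_iterate_bellman_le (π := π) hg hf n s).trans
    (iterate_discExp_mono (fun x => excess_le_enorm_swap x) n s)
  rw [Real.enorm_eq_ofReal_abs]
  rcases abs_choice ((M.bellman π)^[n] f s - (M.bellman π)^[n] g s) with h | h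
  · rw [h]; exact h1
  · rw [h, neg_sub]; exact h2

theorem ApproxGreedy.excess_le {e : S → ℝ} (h : M.ApproxGreedy f e π) (π' : M.Policy) (s : S) :
    excess (M.bellman π' f) (M.bellman π f) s ≤ ENNReal.ofReal (e s) :=
  ENNReal.ofReal_le_ofReal (sub_le_iff_le_add'.2 (h π' s))

/-! ### The value of a policy -/

instance (ν : Measure S) [IsProbabilityMeasure ν] (π : ℕ → M.Policy) (j : ℕ) :
    IsProbabilityMeasure (M.stateLaw ν π j) := by
  induction j with
  | zero => assumption
  | succ j ih => unfold stateLaw; infer_instance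

/-- The value of `π` is the only bounded measurable fixed point of `T_π`. -/
theorem value_eq_of_bellman_eq (hf : BoundedMeasurable f) (h : M.bellman π f = f) :
    M.value π = f := by
  funext s
  set ν : ℕ → Measure S := M.stateLaw (Measure.dirac s) (fun _ => π) with hν
  have hνp : ∀ t, IsProbabilityMeasure (ν t) := fun t => by rw [hν]; infer_instance
  have hr := M.boundedMeasurable_reward π
  have hstep : ∀ t, ∫ y, M.reward π y ∂ν t = ∫ y, f y ∂ν t - M.γ * ∫ y, f y ∂ν (t + 1) := by
    intro t
    have h1 : ∫ y, f y ∂ν (t + 1) = ∫ x, ∫ y, f y ∂M.trans π x ∂ν t := by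
      have heq : ν (t + 1) = (M.trans π ∘ₖ Kernel.const Unit (ν t)) () :=
        Measure.comp_eq_comp_const_apply
      rw [heq, Kernel.integral_comp (hf.integrable _), Kernel.const_apply]
    have h2 : ∀ x, M.γ * ∫ y, f y ∂M.trans π x = f x - M.reward π x := fun x => by
      conv_rhs => rw [← h]
      rw [bellman]; ring
    rw [h1, ← integral_const_mul, integral_congr_ae (Filter.Eventually.of_forall h2),
      integral_sub (hf.integrable _) (hr.integrable _)]
    ring
  have hsum : ∀ n, ∑ t ∈ Finset.range n, M.γ ^ t * ∫ y, M.reward π y ∂ν t =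
      f s - M.γ ^ n * ∫ y, f y ∂ν n := by
    intro n
    induction n with
    | zero =>
      have : ∫ y, f y ∂ν 0 = f s := integral_dirac' _ _ hf.measurable.stronglyMeasurable
      simp [this]
    | succ n ih => rw [Finset.sum_range_succ, ih, hstep]; ring
  obtain ⟨R, hR⟩ := hr.bounded
  obtain ⟨B, hB⟩ := hf.bounded
  have hbound : ∀ (u : S → ℝ) (C : ℝ), (∀ x, |u x| ≤ C) → ∀ t, |M.γ ^ t * ∫ y, u y ∂ν t| ≤
      C * M.γ ^ t := fun u C hC t => by
    rw [abs_mul, abs_of_pos (pow_pos M.γ_pos t), mul_comm]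
    gcongr
    · exact pow_nonneg M.γ_nonneg t
    · exact abs_integral_le_of_abs_le (ν t) hC
  have hgeom := summable_geometric_of_lt_one M.γ_nonneg M.γ_lt_one
  have hsummable : Summable fun t => M.γ ^ t * ∫ y, M.reward π y ∂ν t :=
    Summable.of_norm_bounded (hgeom.mul_left R) (hbound _ R hR)
  have hzero : Filter.Tendsto (fun n => M.γ ^ n * ∫ y, f y ∂ν n) Filter.atTop (nhds 0) := by
    refine squeeze_zero_norm (hbound f B hB) ?_
    simpa using (tendsto_pow_atTop_nhds_zero_of_lt_one M.γ_nonneg M.γ_lt_one).const_mul B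
  refine tendsto_nhds_unique hsummable.hasSum.tendsto_sum_nat ?_
  simp only [hsum]
  simpa using hzero.const_sub (f s)

theorem exists_bellman_fixedPoint (π : M.Policy) :
    ∃ u, BoundedMeasurable u ∧ M.bellman π u = u :=
  exists_fixedPoint_of_contraction (M.bellman π) M.γ_nonneg M.γ_lt_one
    (fun _ hf => boundedMeasurable_bellman π hf) fun _ _ hf hg _ h => abs_bellman_sub_le hf hg h

theorem boundedMeasurable_value (π : M.Policy) : BoundedMeasurable (M.value π) := by
  obtain ⟨u, hu, hfix⟩ := exists_bellman_fixedPoint π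
  rwa [value_eq_of_bellman_eq hu hfix]

theorem bellman_value (π : M.Policy) : M.bellman π (M.value π) = M.value π := by
  obtain ⟨u, hu, hfix⟩ := exists_bellman_fixedPoint π
  rwa [value_eq_of_bellman_eq hu hfix]

theorem tendsto_iterate_bellman (π : M.Policy) (hf : BoundedMeasurable f) (s : S) :
    Filter.Tendsto (fun n => (M.bellman π)^[n] f s) Filter.atTop (nhds (M.value π s)) := by
  have hv := boundedMeasurable_value π
  obtain ⟨C, hC⟩ := (hf.sub hv).bounded
  have h : ∀ n x, |(M.bellman π)^[n] f x - M.value π x| ≤ M.γ ^ n * C := fun n => by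
    induction n with
    | zero => simpa using hC
    | succ n ih =>
      intro x
      have := abs_bellman_sub_le (π := π) (boundedMeasurable_iterate_bellman π hf n) hv ih x
      rw [bellman_value] at this
      rw [Function.iterate_succ_apply']
      exact this.trans_eq (by ring)
  rw [tendsto_iff_dist_tendsto_zero]
  refine squeeze_zero (fun _ => dist_nonneg) (fun n => h n s) ?_
  simpa using (tendsto_pow_atTop_nhds_zero_of_lt_one M.γ_nonneg M.γ_lt_one).mul_const C

theorem excess_iterate_bellman_succ_le (π : M.Policy) (hf : BoundedMeasurable f) (n : ℕ) (s : S) :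
    excess ((M.bellman π)^[n] f) ((M.bellman π)^[n + 1] f) s ≤
      M.discExp^[n] (excess f (M.bellman π f)) s := by
  rw [Function.iterate_succ_apply]
  exact excess_iterate_bellman_le hf (boundedMeasurable_bellman π hf) n s

theorem excess_iterate_bellman_sum_le (π : M.Policy) (hf : BoundedMeasurable f) (n : ℕ) (s : S) :
    excess f ((M.bellman π)^[n] f) s ≤
      ∑ i ∈ Finset.range n, M.discExp^[i] (excess f (M.bellman π f)) s := by
  induction n with
  | zero => simp [excess]
  | succ n ih =>
    rw [Finset.sum_range_succ]
    exact (excess_triangle _ _ _ s).trans (add_le_add ih (excess_iterate_bellman_succ_le π hf n s))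

/-- The decrease from `f` to `v_π`, bounded by the Neumann series of the decrease under one
application of `T_π`. -/
theorem excess_value_le (π : M.Policy) (hf : BoundedMeasurable f) (s : S) :
    excess f (M.value π) s ≤ M.discTail 0 (excess f (M.bellman π f)) s := by
  simp only [discTail, zero_add]
  exact ofReal_sub_le_tsum (tendsto_iterate_bellman π hf s)
    fun i => excess_iterate_bellman_succ_le π hf i s

theorem value_excess_le (π : M.Policy) (hf : BoundedMeasurable f) (s : S) :
    excess (M.value π) f s ≤ M.discTail 0 (excess (M.bellman π f) f) s := by
  have h := ofReal_sub_le_tsum (tendsto_iterate_bellman π hf s).neg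
    (c := fun i => M.discExp^[i] (excess (M.bellman π f) f) s) fun i => by
      rw [neg_sub_neg, Function.iterate_succ_apply]
      exact excess_iterate_bellman_le (boundedMeasurable_bellman π hf) hf i s
  simpa only [discTail, zero_add, neg_sub_neg, excess, Function.iterate_zero_apply] using h

/-! ### Optimal policies -/

section optimal

variable [Finite A] [DiscreteMeasurableSpace A] [Nonempty A]

theorem exists_greedy (hf : BoundedMeasurable f) : ∃ π, M.ApproxGreedy f (fun _ => 0) π := by
  obtain ⟨π, hπ, h⟩ := exists_measurable_argmax
    (fun s a => M.r (s, a) + M.γ * ∫ y, f y ∂M.P (s, a)) fun a =>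
    ((M.measurable_r.add ((hf.measurable.stronglyMeasurable.integral_kernel
      (κ := M.P)).measurable.const_mul _)).comp measurable_prodMk_right)
  have hbellman : ∀ (π' : M.Policy) s,
      M.bellman π' f s = M.r (s, π'.1 s) + M.γ * ∫ y, f y ∂M.P (s, π'.1 s) := fun π' s => by
    rw [bellman, trans_apply, reward]
  refine ⟨⟨π, hπ⟩, fun π' s => ?_⟩
  rw [add_zero]
  exact (hbellman π' s).le.trans ((h s (π'.1 s)).trans (hbellman ⟨π, hπ⟩ s).ge)

/-- Some policy is optimal from every state. It is greedy with respect to the fixed point of the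
Bellman optimality operator. -/
theorem exists_forall_value_le (M : MDP S A) :
    ∃ π, ∀ (π' : M.Policy) (s : S), M.value π' s ≤ M.value π s := by
  have hG : ∀ f : S → ℝ, ∃ π : M.Policy, BoundedMeasurable f →
      M.ApproxGreedy f (fun _ => 0) π := fun f => by
    by_cases hf : BoundedMeasurable f
    · exact (exists_greedy hf).imp fun _ h _ => h
    · exact ⟨⟨fun _ => Classical.arbitrary A, measurable_const⟩, fun h => absurd h hf⟩
  choose G hG using hG
  have hgreedy : ∀ f, BoundedMeasurable f → ∀ (π : M.Policy) s,
      M.bellman π f s ≤ M.bellman (G f) f s := fun f hf π s => by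
    simpa using hG f hf π s
  obtain ⟨u, hu, hfix⟩ := exists_fixedPoint_of_contraction (fun f => M.bellman (G f) f)
    M.γ_nonneg M.γ_lt_one (fun f hf => boundedMeasurable_bellman _ hf) fun f g hf hg C hC s => by
      rw [abs_sub_le_iff]
      have h1 := hgreedy g hg (G f) s
      have h2 := hgreedy f hf (G g) s
      have h3 := (abs_le.1 (abs_bellman_sub_le (π := G f) hf hg hC s)).2
      have h4 := (abs_le.1 (abs_bellman_sub_le (π := G g) hf hg hC s)).1
      constructor <;> linarith
  have hval : M.value (G u) = u := value_eq_of_bellman_eq hu hfix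
  refine ⟨G u, fun π s => ?_⟩
  rw [hval]
  have h0 : excess (M.bellman π u) u = fun _ => 0 := funext fun x => by
    refine ENNReal.ofReal_of_nonpos (sub_nonpos.2 ?_)
    exact (hgreedy u hu π x).trans_eq (congrFun hfix x)
  have h := value_excess_le π hu s
  rw [h0, discTail] at h
  simp only [iterate_discExp_zero, tsum_zero] at h
  exact sub_nonpos.1 (ENNReal.ofReal_eq_zero.1 (le_antisymm h bot_le))

theorem exists_value_eq_optValue (M : MDP S A) : ∃ π, M.value π = M.optValue := by
  obtain ⟨π, hπ⟩ := exists_forall_value_le M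
  have : Nonempty M.Policy := ⟨π⟩
  refine ⟨π, funext fun s => le_antisymm ?_ (ciSup_le fun π' => hπ π' s)⟩
  exact le_ciSup (f := fun π' : M.Policy => M.value π' s)
    ⟨M.value π s, by rintro _ ⟨π', rfl⟩; exact hπ π' s⟩ π

theorem value_le_optValue (π : M.Policy) (s : S) : M.value π s ≤ M.optValue s := by
  obtain ⟨π', hπ'⟩ := exists_forall_value_le M
  exact le_ciSup (f := fun π : M.Policy => M.value π s)
    ⟨M.value π' s, by rintro _ ⟨π, rfl⟩; exact hπ' π s⟩ π

end optimal

end MDP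

namespace MDP

/-! ### Propagation of errors -/

section propagation

variable {S A : Type*} [MeasurableSpace S] [MeasurableSpace A] {M : MDP S A}

/-- The recursion of `MDP.propagation_step`, solved. -/
theorem propagation {F : ℕ → ℕ → S → ℝ≥0∞} {e e' : ℕ → S → ℝ≥0∞} {s : S}
    (hF : ∀ k n, F (k + 1) n s ≤
      F k (n + 1) s + 2 * M.discTail (n + 1) (e (k + 1)) s + M.discTail n (e' (k + 2)) s)
    (k n : ℕ) :
    F k n s ≤ F 0 (n + k) s + 2 * ∑ i ∈ Finset.range k, M.discTail (n + 1 + i) (e (k - i)) s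
      + ∑ i ∈ Finset.range k, M.discTail (n + i) (e' (k + 1 - i)) s := by
  induction k generalizing n with
  | zero => simp
  | succ k ih =>
    refine (hF k n).trans ((add_le_add (add_le_add (ih (n + 1)) le_rfl) le_rfl).trans_eq ?_)
    have h1 : ∑ i ∈ Finset.range k, M.discTail (n + 1 + (i + 1)) (e (k + 1 - (i + 1))) s =
        ∑ i ∈ Finset.range k, M.discTail (n + 1 + 1 + i) (e (k - i)) s :=
      Finset.sum_congr rfl fun i _ => by
        rw [Nat.add_sub_add_right, ← add_assoc, Nat.add_right_comm]
    have h2 : ∑ i ∈ Finset.range k, M.discTail (n + (i + 1)) (e' (k + 1 + 1 - (i + 1))) s =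
        ∑ i ∈ Finset.range k, M.discTail (n + 1 + i) (e' (k + 1 - i)) s :=
      Finset.sum_congr rfl fun i _ => by
        rw [Nat.add_sub_add_right, ← add_assoc, Nat.add_right_comm]
    rw [Finset.sum_range_succ', Finset.sum_range_succ', h1, h2, Nat.sub_zero, Nat.sub_zero,
      add_zero, add_zero, ← Nat.add_assoc n k 1, Nat.add_right_comm n k 1]
    ring

variable [Countable A]

theorem iterate_discExp_sum_le {F : ℕ → S → ℝ≥0∞} (hF : ∀ i, Measurable (F i)) (n m : ℕ) (s : S) :
    M.discExp^[n] (fun x => ∑ i ∈ Finset.range m, F i x) s ≤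
      ∑ i ∈ Finset.range m, M.discExp^[n] (F i) s := by
  induction m with
  | zero => simp [iterate_discExp_zero]
  | succ m ih =>
    simp only [Finset.sum_range_succ]
    exact (iterate_discExp_add_le (Finset.measurable_sum _ fun i _ => hF i) n s).trans
      (add_le_add ih le_rfl)

/-- One step of the error propagation. The quantity propagated at the delay `n` is
`R^n Y + R^(n+1) D + ∑_{j > n} R^j B` with `R = MDP.discExp`, where `D` bounds the distance to the
optimal value, `B` the Bellman residual and `Y` the errors of the current iteration. One more
iteration increases the delay by one, and `H`, `T` are the parts of the Neumann series of `B` that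
`D'` and `B'` inherit. -/
theorem propagation_step {D D' B B' Y H T e e' : S → ℝ≥0∞}
    (hDm : Measurable D) (hYm : Measurable Y) (hTm : Measurable T)
    (he : Measurable e)
    (hD : ∀ s, D' s ≤ M.discExp D s + Y s + H s)
    (hB : ∀ s, B' s ≤ T s + (e s + M.discExp e s + e' s))
    (hHT : ∀ n s, M.discExp^[n + 1] H s + M.discTail (n + 1) T s ≤ M.discTail (n + 2) B s)
    (n : ℕ) (s : S) :
    M.discExp^[n] (fun x => M.discExp e x + e' x) s + M.discExp^[n + 1] D' s
        + M.discTail (n + 1) B' s ≤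
      (M.discExp^[n + 1] Y s + M.discExp^[n + 2] D s + M.discTail (n + 2) B s)
        + 2 * M.discTail (n + 1) e s + M.discTail n e' s := by
  have hRe := measurable_discExp (M := M) he
  have h1 : M.discExp^[n] (fun x => M.discExp e x + e' x) s ≤
      M.discExp^[n + 1] e s + M.discExp^[n] e' s := iterate_discExp_add_le hRe n s
  have h2 : M.discExp^[n + 1] D' s ≤
      M.discExp^[n + 2] D s + M.discExp^[n + 1] Y s + M.discExp^[n + 1] H s := by
    refine (iterate_discExp_mono hD _ s).trans ((iterate_discExp_add_le
      ((measurable_discExp hDm).add hYm) _ s).trans (add_le_add ?_ le_rfl))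
    exact iterate_discExp_add_le (measurable_discExp hDm) _ s
  have h3 : M.discTail (n + 1) B' s ≤ M.discTail (n + 1) T s +
      (M.discTail (n + 1) e s + M.discTail (n + 2) e s + M.discTail (n + 1) e' s) := by
    refine (discTail_mono hB _ s).trans ((discTail_add_le hTm _ s).trans (add_le_add le_rfl ?_))
    refine (discTail_add_le (he.add hRe) _ s).trans (add_le_add ?_ le_rfl)
    refine (discTail_add_le he _ s).trans (add_le_add le_rfl ?_)
    exact (discTail_iterate_discExp (n + 1) 1 e s).le
  calc _ ≤ (M.discExp^[n + 1] e s + M.discExp^[n] e' s)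
        + (M.discExp^[n + 2] D s + M.discExp^[n + 1] Y s + M.discExp^[n + 1] H s)
        + (M.discTail (n + 1) T s +
        (M.discTail (n + 1) e s + M.discTail (n + 2) e s + M.discTail (n + 1) e' s)) :=
      add_le_add (add_le_add h1 h2) h3
    _ = (M.discExp^[n + 1] Y s + M.discExp^[n + 2] D s
        + (M.discExp^[n + 1] H s + M.discTail (n + 1) T s))
        + (M.discTail (n + 1) e s + (M.discExp^[n + 1] e s + M.discTail (n + 2) e s))
        + (M.discExp^[n] e' s + M.discTail (n + 1) e' s) := by ring
    _ ≤ _ := by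
      rw [← discTail_eq_add, ← discTail_eq_add, ← two_mul]
      gcongr
      exact hHT n s

/-- With `R = MDP.discExp`, the parts `∑_{j=1}^m R^j B` and `R^(m+1) B` that evaluation with
parameter `m + 1` hands on satisfy the hypothesis on `H` and `T` in `MDP.propagation_step`. -/
theorem iterate_discExp_sum_add_discTail_le {B : S → ℝ≥0∞} (hB : Measurable B) (m n : ℕ) (s : S) :
    M.discExp^[n + 1] (fun x => ∑ i ∈ Finset.range m, M.discExp^[i + 1] B x) s
      + M.discTail (n + 1) (M.discExp^[m + 1] B) s ≤ M.discTail (n + 2) B s := by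
  refine (add_le_add (iterate_discExp_sum_le (fun i => measurable_iterate_discExp hB (i + 1))
    (n + 1) m s) le_rfl).trans_eq ?_
  rw [discTail_iterate_discExp, discTail, discTail,
    ← Summable.sum_add_tsum_nat_add' (f := fun i => M.discExp^[n + 2 + i] B s) (k := m)
      ENNReal.summable]
  simp only [← Function.iterate_add_apply]
  congr 1
  · refine Finset.sum_congr rfl fun i _ => ?_
    rw [show n + 1 + (i + 1) = n + 2 + i by ring]
  · refine tsum_congr fun i => ?_
    rw [show n + 1 + (m + 1) + i = n + 2 + (i + m) by ring]

end propagation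

/-! ### Pointwise loss bounds -/

section pointwise

variable {S A : Type*} [MeasurableSpace S] [MeasurableSpace A] {M : MDP S A}

theorem boundedMeasurable_bellmanPow (π : M.Policy) (m : ℕ∞) {f : S → ℝ}
    (hf : BoundedMeasurable f) : BoundedMeasurable (M.bellmanPow π m f) := by
  cases m with
  | top => exact boundedMeasurable_value π
  | coe m => exact boundedMeasurable_iterate_bellman π hf m

/-- The exact evaluation `w_k = (T_{π_k})^m v_{k-1}` that `v_k` approximates, with `w_0 = v_0`. -/
def exactValue (M : MDP S A) (m : ℕ∞) (v : ℕ → S → ℝ) (π : ℕ → M.Policy) : ℕ → S → ℝ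
  | 0 => v 0
  | k + 1 => M.bellmanPow (π (k + 1)) m (v k)

theorem boundedMeasurable_exactValue {m : ℕ∞} {v : ℕ → S → ℝ} (π : ℕ → M.Policy)
    (hv : ∀ k, BoundedMeasurable (v k)) (k : ℕ) :
    BoundedMeasurable (M.exactValue m v π k) := by
  cases k with
  | zero => exact hv 0
  | succ k => exact boundedMeasurable_bellmanPow _ _ (hv k)

/-- The exact evaluations of a run of CBMPI form a run of AMPI: the error `v_k - w_k` acts only
through the next evaluation, as `(T_{π_{k+1}})^m v_k - (T_{π_{k+1}})^m w_k`. -/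
theorem IsCBMPI.isAMPI_exactValue {m : ℕ} {v : ℕ → S → ℝ} {π : ℕ → M.Policy}
    {ε ε' : ℕ → S → ℝ} (hC : M.IsCBMPI m v π ε ε') :
    M.IsAMPI m (M.exactValue m v π) π
      (fun k s => M.exactValue m v π k s - M.bellmanPow (π k) m (M.exactValue m v π (k - 1)) s)
      ε' where
  measurable_v k := (boundedMeasurable_exactValue π
    (fun k => ⟨hC.measurable_v k, hC.bounded_v k⟩) k).measurable
  bounded_v k := (boundedMeasurable_exactValue π
    (fun k => ⟨hC.measurable_v k, hC.bounded_v k⟩) k).bounded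
  measurable_greedyError := hC.measurable_greedyError
  greedy k := by
    cases k with
    | zero => exact hC.greedy_one
    | succ k => exact hC.greedy k
  eval k s := by simp

/-- The loss against an optimal policy of anything that follows a greedy step from `v`, where `v`
approximates `w`. -/
theorem excess_optValue_le_of_greedy {πs π : M.Policy} (hπs : M.value πs = M.optValue)
    {v w e' : S → ℝ} (hv : BoundedMeasurable v) (hw : BoundedMeasurable w)
    (h : M.ApproxGreedy v e' π) (g : S → ℝ) (s : S) :
    excess M.optValue g s ≤ M.discExp (excess M.optValue w) s
      + (M.discExp (fun x => ‖v x - w x‖ₑ) s + ENNReal.ofReal (e' s))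
      + excess (M.bellman π v) g s := by
  have hopt : BoundedMeasurable M.optValue := hπs ▸ boundedMeasurable_value πs
  have hfix : M.bellman πs M.optValue = M.optValue := hπs ▸ bellman_value πs
  have h1 : excess M.optValue (M.bellman πs w) s ≤ M.discExp (excess M.optValue w) s := by
    conv_lhs => rw [← hfix]
    exact excess_bellman_le hopt hw s
  have h2 : excess (M.bellman πs w) (M.bellman πs v) s ≤ M.discExp (fun x => ‖v x - w x‖ₑ) s :=
    (excess_bellman_le hw hv s).trans (discExp_mono (fun x => excess_le_enorm_swap x) s)
  refine (excess_triangle _ (M.bellman π v) _ s).trans (add_le_add ?_ le_rfl)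
  refine (excess_triangle _ (M.bellman πs w) _ s).trans (add_le_add h1 ?_)
  exact (excess_triangle _ (M.bellman πs v) _ s).trans (add_le_add h2 (h.excess_le πs s))

/-- The Bellman residual after a greedy step `π'` from `v`, where `v` approximates `w`, compared with
the residual of `w` for the previous policy `π`. -/
theorem excess_bellman_le_residual {π π' : M.Policy} {v w e' : S → ℝ} (hv : BoundedMeasurable v)
    (hw : BoundedMeasurable w) (h : M.ApproxGreedy v e' π') (s : S) :
    excess v (M.bellman π' v) s ≤ excess w (M.bellman π w) s
      + (‖v s - w s‖ₑ + M.discExp (fun x => ‖v x - w x‖ₑ) s + ENNReal.ofReal (e' s)) := by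
  have h1 : excess (M.bellman π w) (M.bellman π v) s ≤ M.discExp (fun x => ‖v x - w x‖ₑ) s :=
    (excess_bellman_le hw hv s).trans (discExp_mono (fun x => excess_le_enorm_swap x) s)
  calc _ ≤ excess v w s + (excess w (M.bellman π w) s + (excess (M.bellman π w) (M.bellman π v) s
        + excess (M.bellman π v) (M.bellman π' v) s)) :=
      (excess_triangle _ w _ s).trans (add_le_add le_rfl
        ((excess_triangle _ (M.bellman π w) _ s).trans (add_le_add le_rfl
          (excess_triangle _ (M.bellman π v) _ s))))
    _ ≤ ‖v s - w s‖ₑ + (excess w (M.bellman π w) s + (M.discExp (fun x => ‖v x - w x‖ₑ) s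
        + ENNReal.ofReal (e' s))) := by
      gcongr
      · exact excess_le_enorm s
      · exact h.excess_le π s
    _ = _ := by ring

variable [Finite A] [DiscreteMeasurableSpace A] [Nonempty A]

theorem boundedMeasurable_optValue (M : MDP S A) : BoundedMeasurable M.optValue := by
  obtain ⟨π, hπ⟩ := exists_value_eq_optValue M
  exact hπ ▸ boundedMeasurable_value π

/-- The contribution of the initial value, in terms of its distance `|v_* - v_0|` to the optimal
value. -/
theorem initial_le_of_dist {π : M.Policy} {v e' : S → ℝ} (hv : BoundedMeasurable v)
    (h : M.ApproxGreedy v e' π) (n : ℕ) (s : S) :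
    M.discExp^[n] (fun x => ENNReal.ofReal (e' x)) s
        + M.discExp^[n + 1] (excess M.optValue v) s
        + M.discTail (n + 1) (excess v (M.bellman π v)) s ≤
      M.discTail n (fun x => ENNReal.ofReal (e' x)) s
        + 2 * M.discTail (n + 1) (fun x => ‖M.optValue x - v x‖ₑ) s := by
  obtain ⟨πs, hπs⟩ := exists_value_eq_optValue M
  have hopt := boundedMeasurable_optValue M
  have hd : Measurable (fun x => ‖M.optValue x - v x‖ₑ) :=
    (hopt.sub hv).measurable.enorm
  have hfix : M.bellman πs M.optValue = M.optValue := hπs ▸ bellman_value πs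
  have hB : ∀ x, excess v (M.bellman π v) x ≤ ‖M.optValue x - v x‖ₑ
      + M.discExp (fun x => ‖M.optValue x - v x‖ₑ) x + ENNReal.ofReal (e' x) := fun x => by
    have h1 : excess M.optValue (M.bellman πs v) x ≤
        M.discExp (fun x => ‖M.optValue x - v x‖ₑ) x := by
      conv_lhs => rw [← hfix]
      exact (excess_bellman_le hopt hv x).trans (discExp_mono (fun x => excess_le_enorm x) x)
    refine (excess_triangle _ (M.bellman πs v) _ x).trans (add_le_add ?_ (h.excess_le πs x))
    exact (excess_triangle _ M.optValue _ x).trans (add_le_add (excess_le_enorm_swap x) h1)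
  have h3 : M.discTail (n + 1) (excess v (M.bellman π v)) s ≤
      M.discTail (n + 1) (fun x => ‖M.optValue x - v x‖ₑ) s
      + M.discTail (n + 2) (fun x => ‖M.optValue x - v x‖ₑ) s
      + M.discTail (n + 1) (fun x => ENNReal.ofReal (e' x)) s := by
    refine (discTail_mono hB _ s).trans
      ((discTail_add_le (hd.add (measurable_discExp hd)) _ s).trans (add_le_add ?_ le_rfl))
    refine (discTail_add_le hd _ s).trans (add_le_add le_rfl ?_)
    exact (discTail_iterate_discExp (n + 1) 1 _ s).le
  refine (add_le_add (add_le_add le_rfl (iterate_discExp_mono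
    (fun x => excess_le_enorm x) _ s)) h3).trans_eq ?_
  rw [discTail_eq_add n, two_mul]
  nth_rw 3 [discTail_eq_add (n + 1) fun x => ‖M.optValue x - v x‖ₑ]
  ring

/-- The contribution of the initial value, in terms of its Bellman residual
`|v_0 - T_{π_1} v_0|`. -/
theorem initial_le_of_residual {π : M.Policy} {v e' : S → ℝ} (hv : BoundedMeasurable v)
    (he' : Measurable e')
    (h : M.ApproxGreedy v e' π) (n : ℕ) (s : S) :
    M.discExp^[n] (fun x => ENNReal.ofReal (e' x)) s
        + M.discExp^[n + 1] (excess M.optValue v) s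
        + M.discTail (n + 1) (excess v (M.bellman π v)) s ≤
      M.discTail n (fun x => ENNReal.ofReal (e' x)) s
        + 2 * M.discTail (n + 1) (fun x => ‖v x - M.bellman π v x‖ₑ) s := by
  obtain ⟨πs, hπs⟩ := exists_value_eq_optValue M
  have hb : Measurable (fun x => ‖v x - M.bellman π v x‖ₑ) :=
    (hv.sub (boundedMeasurable_bellman π hv)).measurable.enorm
  have he'm : Measurable (fun x => ENNReal.ofReal (e' x)) := he'.ennreal_ofReal
  have hD : ∀ x, excess M.optValue v x ≤
      M.discTail 0 (fun x => ‖v x - M.bellman π v x‖ₑ + ENNReal.ofReal (e' x)) x := fun x => by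
    rw [← hπs]
    refine (value_excess_le πs hv x).trans (discTail_mono (fun y => ?_) 0 x)
    rw [add_comm]
    exact (excess_triangle _ (M.bellman π v) _ y).trans
      (add_le_add (h.excess_le πs y) (excess_le_enorm_swap y))
  have h2 : M.discExp^[n + 1] (excess M.optValue v) s ≤
      M.discTail (n + 1) (fun x => ‖v x - M.bellman π v x‖ₑ) s
      + M.discTail (n + 1) (fun x => ENNReal.ofReal (e' x)) s :=
    (iterate_discExp_mono hD _ s).trans
      ((iterate_discExp_discTail_le (hb.add he'm) _ _ s).trans (discTail_add_le hb _ s))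
  refine (add_le_add (add_le_add le_rfl h2)
    (discTail_mono (fun x => excess_le_enorm x) _ s)).trans_eq ?_
  rw [discTail_eq_add n, two_mul]
  ring

/-- The loss of the policy obtained after `k + 1` iterations of AMPI, bounded pointwise by the
Neumann tails of the errors. The function `h₀` stands for either of the two measures of the error
of the initial value. -/
theorem IsAMPI.excess_le {m : ℕ∞} (hm : 1 ≤ m) {v : ℕ → S → ℝ} {π : ℕ → M.Policy}
    {ε ε' : ℕ → S → ℝ} (hA : M.IsAMPI m v π ε ε') {h₀ : S → ℝ≥0∞}
    (hh₀ : h₀ = (fun x => ‖M.optValue x - v 0 x‖ₑ) ∨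
      h₀ = (fun x => ‖v 0 x - M.bellman (π 1) (v 0) x‖ₑ)) (k : ℕ) (s : S) :
    excess M.optValue (M.value (π (k + 1))) s ≤
      2 * ∑ i ∈ Finset.range k, M.discTail (1 + i) (fun x => ‖ε (k - i) x‖ₑ) s
      + ∑ i ∈ Finset.range (k + 1), M.discTail i (fun x => ENNReal.ofReal (ε' (k + 1 - i) x)) s
      + 2 * M.discTail (k + 1) h₀ s := by
  obtain ⟨πs, hπs⟩ := exists_value_eq_optValue M
  have hopt := boundedMeasurable_optValue M
  have hv : ∀ k, BoundedMeasurable (v k) := fun k => ⟨hA.measurable_v k, hA.bounded_v k⟩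
  set w := M.exactValue m v π with hwdef
  have hw : ∀ k, BoundedMeasurable (w k) := boundedMeasurable_exactValue π hv
  set D : ℕ → S → ℝ≥0∞ := fun k => excess M.optValue (w k) with hD
  set B : ℕ → S → ℝ≥0∞ := fun k => excess (v k) (M.bellman (π (k + 1)) (v k)) with hB
  -- The evaluation error vanishes at `k = 0`, where `w 0 = v 0`.
  set e : ℕ → S → ℝ≥0∞ := fun k x => ‖v k x - w k x‖ₑ with he
  set e' : ℕ → S → ℝ≥0∞ := fun k x => ENNReal.ofReal (ε' k x) with he'
  have hem : ∀ k, Measurable (e k) := fun k => ((hv k).sub (hw k)).measurable.enorm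
  have he'm : ∀ k, Measurable (e' k) := fun k => (hA.measurable_greedyError k).ennreal_ofReal
  have hDm : ∀ k, Measurable (D k) := fun k => measurable_excess hopt.measurable (hw k).measurable
  have hBm : ∀ k, Measurable (B k) := fun k => measurable_excess (hv k).measurable
    (boundedMeasurable_bellman _ (hv k)).measurable
  have hε : ∀ k, e (k + 1) = fun x => ‖ε (k + 1) x‖ₑ := fun k => by
    funext x
    simp only [he, hA.eval k x, hwdef, exactValue, add_sub_cancel_left]
  set F : ℕ → ℕ → S → ℝ≥0∞ := fun k n s =>
    M.discExp^[n] (fun x => M.discExp (e k) x + e' (k + 1) x) s + M.discExp^[n + 1] (D k) s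
      + M.discTail (n + 1) (B k) s with hF
  have hTv : ∀ k, BoundedMeasurable (M.bellman (π (k + 1)) (v k)) := fun k =>
    boundedMeasurable_bellman _ (hv k)
  have hopt_le : ∀ k g x, excess M.optValue g x ≤ M.discExp (D k) x
      + (M.discExp (e k) x + e' (k + 1) x) + excess (M.bellman (π (k + 1)) (v k)) g x :=
    fun k g x => excess_optValue_le_of_greedy hπs (hv k) (hw k) (hA.greedy k) g x
  have hres : ∀ k x, excess (M.bellman (π (k + 1)) (v k))
      (M.bellman (π (k + 1)) (M.bellman (π (k + 1)) (v k))) x ≤ M.discExp (B k) x :=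
    fun k x => excess_bellman_le (hv k) (hTv k) x
  have hvalue : ∀ k x, excess (M.bellman (π (k + 1)) (v k)) (M.value (π (k + 1))) x ≤
      M.discTail 1 (B k) x := fun k x =>
    (excess_value_le _ (hTv k) x).trans ((discTail_mono (hres k) 0 x).trans_eq
      (discTail_iterate_discExp 0 1 (B k) x))
  have hstep : ∀ k n, F (k + 1) n s ≤
      F k (n + 1) s + 2 * M.discTail (n + 1) (e (k + 1)) s + M.discTail n (e' (k + 2)) s := by
    intro k n
    have hYm := (measurable_discExp (M := M) (hem k)).add (he'm (k + 1))
    cases m with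
    | top =>
      refine propagation_step (H := M.discTail 1 (B k)) (T := fun _ => 0) (hDm k) hYm
        measurable_const (hem (k + 1)) (fun x => ?_) (fun x => ?_) (fun n x => ?_) n s
      · exact (hopt_le k _ x).trans (add_le_add le_rfl (hvalue k x))
      · refine (excess_bellman_le_residual (π := π (k + 1)) (hv (k + 1)) (hw (k + 1))
          (hA.greedy (k + 1)) x).trans (add_le_add ?_ le_rfl)
        have : M.bellman (π (k + 1)) (w (k + 1)) = w (k + 1) := bellman_value _
        rw [this, excess, sub_self, ENNReal.ofReal_zero]
      · have h0 : M.discTail (n + 1) (fun _ => 0) x = 0 := by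
          simp [discTail, iterate_discExp_zero]
        rw [h0, add_zero]
        exact iterate_discExp_discTail_le (hBm k) _ _ x
    | coe m =>
      obtain ⟨j, rfl⟩ : ∃ j, m = j + 1 := ⟨m - 1, by
        have : 1 ≤ m := by exact_mod_cast hm
        omega⟩
      have hwk : w (k + 1) = (M.bellman (π (k + 1)))^[j + 1] (v k) := rfl
      refine propagation_step (H := fun x => ∑ i ∈ Finset.range j, M.discExp^[i + 1] (B k) x)
        (T := M.discExp^[j + 1] (B k)) (hDm k) hYm (measurable_iterate_discExp (hBm k) _)
        (hem (k + 1)) (fun x => ?_) (fun x => ?_)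
        (iterate_discExp_sum_add_discTail_le (hBm k) j) n s
      · refine (hopt_le k _ x).trans (add_le_add le_rfl ?_)
        rw [hwk, Function.iterate_succ_apply]
        exact (excess_iterate_bellman_sum_le _ (hTv k) j x).trans
          (Finset.sum_le_sum fun i _ => iterate_discExp_mono (hres k) i x)
      · refine (excess_bellman_le_residual (π := π (k + 1)) (hv (k + 1)) (hw (k + 1))
          (hA.greedy (k + 1)) x).trans (add_le_add ?_ le_rfl)
        rw [hwk, ← Function.iterate_succ_apply' (M.bellman (π (k + 1)))]
        exact excess_iterate_bellman_succ_le _ (hv k) _ x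
  have hloss : excess M.optValue (M.value (π (k + 1))) s ≤ F k 0 s := by
    refine (hopt_le k _ s).trans ((add_le_add le_rfl (hvalue k s)).trans_eq ?_)
    simp only [hF, Function.iterate_zero, id_eq, zero_add, Function.iterate_one]
    ring
  have hinit : F 0 k s ≤ M.discTail k (e' 1) s + 2 * M.discTail (k + 1) h₀ s := by
    have he0 : e 0 = fun _ => 0 := funext fun x => by simp [he, hwdef, exactValue]
    have hY : (fun x => M.discExp (e 0) x + e' (0 + 1) x) = e' 1 := funext fun x => by
      rw [he0, discExp_zero, zero_add]
    simp only [hF, hY]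
    rcases hh₀ with rfl | rfl
    · exact initial_le_of_dist (hv 0) (hA.greedy 0) k s
    · exact initial_le_of_residual (hv 0) (hA.measurable_greedyError 1) (hA.greedy 0) k s
  have hsum : ∑ i ∈ Finset.range k, M.discTail (1 + i) (e (k - i)) s =
      ∑ i ∈ Finset.range k, M.discTail (1 + i) (fun x => ‖ε (k - i) x‖ₑ) s := by
    refine Finset.sum_congr rfl fun i hi => ?_
    obtain ⟨j, hj⟩ : ∃ j, k - i = j + 1 := ⟨k - i - 1, by have := Finset.mem_range.1 hi; omega⟩
    rw [hj, hε]
  refine hloss.trans ((propagation hstep k 0).trans ?_)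
  simp only [zero_add]
  rw [hsum, Finset.sum_range_succ, Nat.add_sub_cancel_left]
  refine (add_le_add (add_le_add hinit le_rfl) le_rfl).trans_eq ?_
  ring

end pointwise

end MDP

/-! ### Hölder and Jensen inequalities in `[0, ∞]` -/

section inequalities

variable {S : Type*} [MeasurableSpace S]

/-- Hölder's inequality for `[0, ∞]`-valued functions, endpoints included. -/
theorem lintegral_mul_le_eLpNorm_mul_eLpNorm {μ : Measure S} {f g : S → ℝ≥0∞}
    (hf : AEMeasurable f μ) (hg : AEMeasurable g μ) {q q' : ℝ≥0∞} (hq : q⁻¹ + q'⁻¹ = 1) :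
    ∫⁻ x, f x * g x ∂μ ≤ eLpNorm f q μ * eLpNorm g q' μ := by
  have key : ∀ {f g : S → ℝ≥0∞}, AEMeasurable g μ →
      ∫⁻ x, f x * g x ∂μ ≤ eLpNorm f ∞ μ * eLpNorm g 1 μ := fun {f g} hg => by
    rw [eLpNorm_exponent_top, eLpNorm_one_eq_lintegral_enorm]
    simp only [enorm_eq_self]
    rw [← lintegral_const_mul'' _ hg]
    refine lintegral_mono_ae ?_
    filter_upwards [enorm_ae_le_eLpNormEssSup f μ] with x hx
    exact mul_le_mul_left (by simpa using hx) _
  by_cases hqt : q = ∞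
  · have hq' : q' = 1 := by simpa [hqt] using hq
    subst hqt hq'
    exact key hg
  by_cases hqt' : q' = ∞
  · have hq' : q = 1 := by simpa [hqt'] using hq
    subst hqt' hq'
    simpa only [mul_comm] using key (f := g) hf
  have hc : q.HolderConjugate q' := ENNReal.holderConjugate_iff.2 hq
  have hq0 : q ≠ 0 := by rintro rfl; simp at hq
  have hq0' : q' ≠ 0 := by rintro rfl; simp at hq
  have hr : q.toReal.HolderConjugate q'.toReal := by
    rw [Real.holderConjugate_iff]
    have hsum : q.toReal⁻¹ + q'.toReal⁻¹ = 1 := by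
      rw [← ENNReal.toReal_inv, ← ENNReal.toReal_inv, ← ENNReal.toReal_add
        (ENNReal.inv_ne_top.2 hq0) (ENNReal.inv_ne_top.2 hq0'), hq, ENNReal.toReal_one]
    refine ⟨?_, hsum⟩
    have h0 := ENNReal.toReal_pos hq0 hqt
    have h0' := inv_pos.2 (ENNReal.toReal_pos hq0' hqt')
    by_contra! h
    have := one_le_inv_iff₀.2 ⟨h0, h⟩
    linarith
  rw [eLpNorm_eq_lintegral_rpow_enorm_toReal hq0 hqt,
    eLpNorm_eq_lintegral_rpow_enorm_toReal hq0' hqt']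
  simp only [enorm_eq_self]
  exact ENNReal.lintegral_mul_le_Lp_mul_Lq μ hr hf hg

/-- Jensen's inequality for powers. -/
theorem rpow_lintegral_le_lintegral_rpow (ν : Measure S) [IsProbabilityMeasure ν] {f : S → ℝ≥0∞}
    (hf : AEMeasurable f ν) {p : ℝ} (hp : 1 ≤ p) :
    (∫⁻ x, f x ∂ν) ^ p ≤ ∫⁻ x, f x ^ p ∂ν := by
  have h := eLpNorm'_le_eLpNorm'_of_exponent_le zero_lt_one hp ν hf.aestronglyMeasurable
  simp only [eLpNorm'_eq_lintegral_enorm, enorm_eq_self, ENNReal.rpow_one, div_one] at h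
  rwa [one_div, ENNReal.le_rpow_inv_iff (zero_lt_one.trans_le hp)] at h

theorem rpow_tsum_mul_le_tsum_mul_rpow {a x : ℕ → ℝ≥0∞} (ha : ∑' n, a n = 1) {p : ℝ}
    (hp : 1 ≤ p) : (∑' n, a n * x n) ^ p ≤ ∑' n, a n * x n ^ p := by
  set ν : Measure ℕ := Measure.sum fun n => a n • Measure.dirac n with hν
  have hint : ∀ f : ℕ → ℝ≥0∞, ∫⁻ n, f n ∂ν = ∑' n, a n * f n := fun f => by
    rw [hν, lintegral_sum_measure]
    simp
  have : IsProbabilityMeasure ν := ⟨by rw [← lintegral_one, hint]; simpa using ha⟩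
  rw [← hint, ← hint]
  exact rpow_lintegral_le_lintegral_rpow ν measurable_from_nat.aemeasurable hp

end inequalities

namespace MDP

variable {S A : Type*} [MeasurableSpace S] [MeasurableSpace A] {M : MDP S A}

/-! ### Norm bounds for the Neumann tails -/

theorem maxExp_const_mul {c : ℝ≥0∞} (hc : c ≠ ∞) (f : S → ℝ≥0∞) (s : S) :
    M.maxExp (fun x => c * f x) s = c * M.maxExp f s := by
  simp only [maxExp, lintegral_const_mul' _ _ hc, ENNReal.mul_iSup]

theorem iterate_discExp_eq (n : ℕ) (f : S → ℝ≥0∞) (s : S) :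
    M.discExp^[n] f s = ENNReal.ofReal (M.γ ^ n) * M.maxExp^[n] f s := by
  induction n generalizing s with
  | zero => simp
  | succ n ih =>
    rw [Function.iterate_succ_apply', Function.iterate_succ_apply', discExp, funext ih,
      maxExp_const_mul ENNReal.ofReal_ne_top, ← mul_assoc, ← ENNReal.ofReal_mul M.γ_nonneg,
      pow_succ']

theorem concentrability_succ (M : MDP S A) (ρ μ : Measure S) (q : ℝ≥0∞) (i d : ℕ) :
    M.concentrability ρ μ q i (i + 1) d =
      ∑' n, ENNReal.ofReal ((1 - M.γ) * M.γ ^ n) * M.concCoeff ρ μ q (i + n + d) := by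
  have h1 : 1 - M.γ ≠ 0 := (sub_pos.2 M.γ_lt_one).ne'
  have h2 : M.γ ^ i ≠ 0 := (pow_pos M.γ_pos i).ne'
  have h3 : 0 ≤ (1 - M.γ) ^ 2 / (M.γ ^ i - M.γ ^ (i + 1)) := by
    have : M.γ ^ i - M.γ ^ (i + 1) = M.γ ^ i * (1 - M.γ) := by ring
    rw [this]
    exact div_nonneg (sq_nonneg _)
      (mul_nonneg (pow_nonneg M.γ_nonneg i) (sub_pos.2 M.γ_lt_one).le)
  rw [concentrability, Nat.Ico_succ_singleton, Finset.sum_singleton, ← ENNReal.tsum_mul_left]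
  refine tsum_congr fun n => ?_
  rw [← mul_assoc, ← ENNReal.ofReal_mul h3]
  congr 2
  rw [show M.γ ^ i - M.γ ^ (i + 1) = M.γ ^ i * (1 - M.γ) by ring, pow_add]
  field_simp

theorem stateLaw_congr (ν : Measure S) {π π' : ℕ → M.Policy} {j : ℕ}
    (h : ∀ i < j, π i = π' i) : M.stateLaw ν π j = M.stateLaw ν π' j := by
  induction j with
  | zero => rfl
  | succ j ih =>
    rw [stateLaw, stateLaw, ih fun i hi => h i (hi.trans j.lt_succ_self), h j j.lt_succ_self]

section

variable [Countable A]

theorem measurable_iterate_maxExp {f : S → ℝ≥0∞} (hf : Measurable f) (n : ℕ) :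
    Measurable (M.maxExp^[n] f) := by
  induction n with
  | zero => exact hf
  | succ n ih => simpa only [Function.iterate_succ_apply'] using measurable_maxExp ih

theorem rpow_iterate_maxExp_le {f : S → ℝ≥0∞} (hf : Measurable f) {p : ℝ} (hp : 1 ≤ p) (n : ℕ)
    (s : S) : (M.maxExp^[n] f s) ^ p ≤ M.maxExp^[n] (fun x => f x ^ p) s := by
  induction n generalizing s with
  | zero => exact le_rfl
  | succ n ih =>
    simp only [Function.iterate_succ_apply']
    refine le_trans ?_ (maxExp_mono ih s)
    rw [← ENNReal.le_rpow_inv_iff (zero_lt_one.trans_le hp)]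
    refine iSup_le fun a => ?_
    rw [ENNReal.le_rpow_inv_iff (zero_lt_one.trans_le hp)]
    exact (rpow_lintegral_le_lintegral_rpow _
      (measurable_iterate_maxExp hf n).aemeasurable hp).trans
      (le_iSup (fun a => ∫⁻ y, M.maxExp^[n] f y ^ p ∂M.P (s, a)) a)

end

variable [Finite A] [DiscreteMeasurableSpace A] [Nonempty A]

/-- Iterates of the maximal expectation are attained by a sequence of policies, chosen by measurable
selection. -/
theorem exists_lintegral_iterate_maxExp_eq (ρ : Measure S) (j : ℕ) {f : S → ℝ≥0∞}
    (hf : Measurable f) : ∃ π : ℕ → M.Policy,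
      ∫⁻ s, M.maxExp^[j] f s ∂ρ = ∫⁻ s, f s ∂M.stateLaw ρ π j := by
  induction j generalizing f with
  | zero => exact ⟨fun _ => ⟨fun _ => Classical.arbitrary A, measurable_const⟩, rfl⟩
  | succ j ih =>
    obtain ⟨π, hπ⟩ := ih (measurable_maxExp (M := M) hf)
    obtain ⟨σ, hσ, hmax⟩ := exists_measurable_argmax (fun s a => ∫⁻ y, f y ∂M.P (s, a))
      fun a => hf.lintegral_kernel.comp measurable_prodMk_right
    let σ' : M.Policy := ⟨σ, hσ⟩
    have heq : ∀ s, M.maxExp f s = ∫⁻ y, f y ∂M.trans σ' s := fun s => by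
      rw [trans_apply]
      exact le_antisymm (iSup_le (hmax s)) (le_iSup (fun a => ∫⁻ y, f y ∂M.P (s, a)) (σ s))
    refine ⟨Function.update π j σ', ?_⟩
    rw [Function.iterate_succ_apply, hπ, stateLaw, Function.update_self,
      Measure.lintegral_bind (M.trans σ').aemeasurable hf.aemeasurable,
      stateLaw_congr ρ fun i hi => Function.update_of_ne hi.ne σ' π]
    exact lintegral_congr heq

theorem lintegral_iterate_maxExp_le {ρ μ : Measure S} [IsProbabilityMeasure ρ]
    [IsProbabilityMeasure μ] (hac : ∀ (π : ℕ → M.Policy) (j : ℕ), M.stateLaw ρ π j ≪ μ)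
    {q q' : ℝ≥0∞} (hq : q⁻¹ + q'⁻¹ = 1) (j : ℕ) {f : S → ℝ≥0∞} (hf : Measurable f) :
    ∫⁻ s, M.maxExp^[j] f s ∂ρ ≤ M.concCoeff ρ μ q j * eLpNorm f q' μ := by
  obtain ⟨π, hπ⟩ := exists_lintegral_iterate_maxExp_eq (M := M) ρ j hf
  rw [hπ, ← lintegral_rnDeriv_mul (hac π j) hf.aemeasurable]
  refine (lintegral_mul_le_eLpNorm_mul_eLpNorm (Measure.measurable_rnDeriv _ _).aemeasurable
    hf.aemeasurable hq).trans (mul_le_mul_left ?_ _)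
  exact le_iSup (fun π : ℕ → M.Policy => eLpNorm ((M.stateLaw ρ π j).rnDeriv μ) q μ) π

/-- A Neumann tail in `L^p(ρ)`: Jensen's inequality for the probability weights `(1 - γ) γ^n` and
for the transition kernels reduces the claim to integrals of `f ^ p` against state laws, which
Hölder's inequality bounds by the concentrability coefficients. -/
theorem eLpNorm_discTail_iterate_le {ρ μ : Measure S} [IsProbabilityMeasure ρ]
    [IsProbabilityMeasure μ] (hac : ∀ (π : ℕ → M.Policy) (j : ℕ), M.stateLaw ρ π j ≪ μ)
    {p : ℝ≥0} (hp : 1 ≤ p) {q q' : ℝ≥0∞} (hq : q⁻¹ + q'⁻¹ = 1) (i d : ℕ) {f : S → ℝ≥0∞}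
    (hf : Measurable f) :
    eLpNorm (M.discTail i (M.discExp^[d] f)) p ρ ≤
      ENNReal.ofReal (M.γ ^ d) * (M.weight ρ μ p q i d * eLpNorm f (p * q') μ) := by
  have hp1 : (1 : ℝ) ≤ p := by exact_mod_cast hp
  have hp0 : (0 : ℝ) < p := zero_lt_one.trans_le hp1
  have hγ1 : 0 < 1 - M.γ := sub_pos.2 M.γ_lt_one
  set K : ℝ≥0∞ := ENNReal.ofReal (M.γ ^ d) * ENNReal.ofReal (M.γ ^ i / (1 - M.γ)) with hK
  set a : ℕ → ℝ≥0∞ := fun n => ENNReal.ofReal ((1 - M.γ) * M.γ ^ n) with ha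
  have ha1 : ∑' n, a n = 1 := by
    have hs := (hasSum_geometric_of_lt_one M.γ_nonneg M.γ_lt_one).mul_left (1 - M.γ)
    rw [mul_inv_cancel₀ hγ1.ne'] at hs
    rw [ha, ← ENNReal.ofReal_tsum_of_nonneg
      (fun n => mul_nonneg hγ1.le (pow_nonneg M.γ_nonneg n)) hs.summable, hs.tsum_eq,
      ENNReal.ofReal_one]
  have heq : ∀ s, M.discTail i (M.discExp^[d] f) s =
      K * ∑' n, a n * M.maxExp^[i + n + d] f s := fun s => by
    rw [discTail_iterate_discExp, discTail, ← ENNReal.tsum_mul_left]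
    refine tsum_congr fun n => ?_
    rw [Nat.add_right_comm i d n, iterate_discExp_eq, hK, ha, ← mul_assoc,
      ← ENNReal.ofReal_mul (pow_nonneg M.γ_nonneg d), ← ENNReal.ofReal_mul
        (mul_nonneg (pow_nonneg M.γ_nonneg d) (div_nonneg (pow_nonneg M.γ_nonneg i) hγ1.le))]
    congr 2
    rw [pow_add, pow_add]
    field_simp
  have hfp : Measurable fun x => f x ^ (p : ℝ) := hf.pow_const _
  have hnorm : eLpNorm (fun x => f x ^ (p : ℝ)) q' μ = eLpNorm f (p * q') μ ^ (p : ℝ) := by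
    have := eLpNorm_enorm_rpow (p := q') (μ := μ) f hp0
    simpa [mul_comm] using this
  have hint : ∫⁻ s, (∑' n, a n * M.maxExp^[i + n + d] f s) ^ (p : ℝ) ∂ρ ≤
      M.concentrability ρ μ q i (i + 1) d * eLpNorm f (p * q') μ ^ (p : ℝ) :=
    calc _ ≤ ∫⁻ s, ∑' n, a n * M.maxExp^[i + n + d] (fun x => f x ^ (p : ℝ)) s ∂ρ :=
        lintegral_mono fun s => (rpow_tsum_mul_le_tsum_mul_rpow ha1 hp1).trans
          (ENNReal.tsum_le_tsum fun n => mul_le_mul_right (rpow_iterate_maxExp_le hf hp1 _ s) _)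
      _ = ∑' n, a n * ∫⁻ s, M.maxExp^[i + n + d] (fun x => f x ^ (p : ℝ)) s ∂ρ := by
        rw [lintegral_tsum fun n => ((measurable_iterate_maxExp hfp _).const_mul _).aemeasurable]
        exact tsum_congr fun n => lintegral_const_mul _ (measurable_iterate_maxExp hfp _)
      _ ≤ ∑' n, a n * (M.concCoeff ρ μ q (i + n + d) * eLpNorm f (p * q') μ ^ (p : ℝ)) := by
        rw [← hnorm]
        exact ENNReal.tsum_le_tsum fun n =>
          mul_le_mul_right (lintegral_iterate_maxExp_le hac hq _ hfp) _
      _ = _ := by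
        simp only [← mul_assoc, ENNReal.tsum_mul_right, concentrability_succ, ha]
  rw [eLpNorm_eq_lintegral_rpow_enorm_toReal (by exact_mod_cast (zero_lt_one.trans_le hp).ne')
    ENNReal.coe_ne_top, funext heq]
  simp only [enorm_eq_self, ENNReal.coe_toReal, ENNReal.mul_rpow_of_nonneg _ _ hp0.le]
  rw [lintegral_const_mul' _ _ (ENNReal.rpow_ne_top_of_nonneg hp0.le
    (ENNReal.mul_ne_top ENNReal.ofReal_ne_top ENNReal.ofReal_ne_top)),
    ENNReal.mul_rpow_of_nonneg _ _ (by positivity), one_div, ENNReal.rpow_rpow_inv hp0.ne',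
    weight, one_div]
  calc _ ≤ K * (M.concentrability ρ μ q i (i + 1) d * eLpNorm f (p * q') μ ^ (p : ℝ))
        ^ (p : ℝ)⁻¹ := by gcongr
    _ = _ := by
      rw [ENNReal.mul_rpow_of_nonneg _ _ (by positivity), ENNReal.rpow_rpow_inv hp0.ne', hK]
      ring

theorem eLpNorm_discTail_le {ρ μ : Measure S} [IsProbabilityMeasure ρ]
    [IsProbabilityMeasure μ] (hac : ∀ (π : ℕ → M.Policy) (j : ℕ), M.stateLaw ρ π j ≪ μ)
    {p : ℝ≥0} (hp : 1 ≤ p) {q q' : ℝ≥0∞} (hq : q⁻¹ + q'⁻¹ = 1) (i : ℕ) {f : S → ℝ≥0∞}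
    (hf : Measurable f) :
    eLpNorm (M.discTail i f) p ρ ≤ M.weight ρ μ p q i 0 * eLpNorm f (p * q') μ := by
  simpa using eLpNorm_discTail_iterate_le hac hp hq i 0 hf

/-! ### Loss bounds in norm -/

/-- Minkowski's inequality for the pointwise loss bound. The greedy step errors are nonnegative, so
nothing is lost in replacing them by their positive parts. -/
theorem IsAMPI.eLpNorm_loss_le {ρ μ : Measure S} [IsProbabilityMeasure ρ]
    [IsProbabilityMeasure μ] (hac : ∀ (π : ℕ → M.Policy) (j : ℕ), M.stateLaw ρ π j ≪ μ)
    {p : ℝ≥0} (hp : 1 ≤ p) {q q' : ℝ≥0∞} (hq : q⁻¹ + q'⁻¹ = 1)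
    {m : ℕ∞} (hm : 1 ≤ m) {v : ℕ → S → ℝ} {π : ℕ → M.Policy}
    {ε ε' : ℕ → S → ℝ} (hA : M.IsAMPI m v π ε ε') (hε : ∀ k, Measurable (ε (k + 1))) (k : ℕ) :
    eLpNorm (M.loss (π (k + 1))) p ρ ≤
      2 * ∑ i ∈ Finset.range k, eLpNorm (M.discTail (1 + i) fun x => ‖ε (k - i) x‖ₑ) p ρ
      + ∑ i ∈ Finset.range (k + 1),
          M.weight ρ μ p q i 0 * eLpNorm (ε' (k + 1 - i)) (p * q') μ
      + M.initTerm ρ μ p q q' (v 0) (π 1) (k + 1) := by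
  have hp' : (1 : ℝ≥0∞) ≤ p := by exact_mod_cast hp
  have hv0 : BoundedMeasurable (v 0) := ⟨hA.measurable_v 0, hA.bounded_v 0⟩
  have key : ∀ h₀ : S → ℝ, Measurable h₀ → ((fun x => ‖h₀ x‖ₑ) =
      (fun x => ‖M.optValue x - v 0 x‖ₑ) ∨
      (fun x => ‖h₀ x‖ₑ) = (fun x => ‖v 0 x - M.bellman (π 1) (v 0) x‖ₑ)) →
      eLpNorm (M.loss (π (k + 1))) p ρ ≤
      2 * ∑ i ∈ Finset.range k, eLpNorm (M.discTail (1 + i) fun x => ‖ε (k - i) x‖ₑ) p ρ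
      + ∑ i ∈ Finset.range (k + 1),
          M.weight ρ μ p q i 0 * eLpNorm (ε' (k + 1 - i)) (p * q') μ
      + 2 * M.weight ρ μ p q (k + 1) 0 * eLpNorm h₀ (p * q') μ := by
    intro h₀ hh₀m hh₀
    set a : ℕ → S → ℝ≥0∞ := fun i => M.discTail (1 + i) fun x => ‖ε (k - i) x‖ₑ with ha
    set b : ℕ → S → ℝ≥0∞ := fun i =>
      M.discTail i fun x => ENNReal.ofReal (ε' (k + 1 - i) x) with hb
    set c : S → ℝ≥0∞ := M.discTail (k + 1) fun x => ‖h₀ x‖ₑ with hc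
    have ham : ∀ i ∈ Finset.range k, AEStronglyMeasurable (a i) ρ := fun i hi => by
      obtain ⟨j, hj⟩ : ∃ j, k - i = j + 1 :=
        ⟨k - i - 1, by have := Finset.mem_range.1 hi; omega⟩
      simp only [ha, hj]
      exact (measurable_discTail (hε j).enorm _).aestronglyMeasurable
    have hbm : ∀ i, AEStronglyMeasurable (b i) ρ := fun i => (measurable_discTail
      (hA.measurable_greedyError _).ennreal_ofReal _).aestronglyMeasurable
    have hcm : AEStronglyMeasurable c ρ := (measurable_discTail hh₀m.enorm _).aestronglyMeasurable
    have hpt : ∀ s, ‖M.loss (π (k + 1)) s‖ₑ ≤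
        ‖((∑ i ∈ Finset.range k, a i + ∑ i ∈ Finset.range k, a i)
          + ∑ i ∈ Finset.range (k + 1), b i + (c + c)) s‖ₑ := fun s => by
      have h := hA.excess_le hm hh₀ k s
      rw [two_mul, two_mul] at h
      rw [enorm_eq_self, loss, Real.enorm_eq_ofReal (sub_nonneg.2 (value_le_optValue _ s))]
      simp only [Pi.add_apply, Finset.sum_apply]
      exact h
    have hsa := Finset.aestronglyMeasurable_sum (Finset.range k) ham
    have hsb := Finset.aestronglyMeasurable_sum (Finset.range (k + 1)) fun i _ => hbm i
    have hNa := eLpNorm_sum_le ham hp'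
    have hNb : eLpNorm (∑ i ∈ Finset.range (k + 1), b i) p ρ ≤ ∑ i ∈ Finset.range (k + 1),
        M.weight ρ μ p q i 0 * eLpNorm (ε' (k + 1 - i)) (p * q') μ := by
      refine (eLpNorm_sum_le (fun i _ => hbm i) hp').trans (Finset.sum_le_sum fun i _ => ?_)
      refine (eLpNorm_discTail_le hac hp hq i
        (hA.measurable_greedyError (k + 1 - i)).ennreal_ofReal).trans (mul_le_mul_right ?_ _)
      refine eLpNorm_mono_enorm fun x => ?_
      rw [enorm_eq_self, Real.enorm_eq_ofReal_abs]
      exact ENNReal.ofReal_le_ofReal (le_abs_self _)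
    have hNc : eLpNorm c p ρ ≤ M.weight ρ μ p q (k + 1) 0 * eLpNorm h₀ (p * q') μ := by
      refine (eLpNorm_discTail_le hac hp hq (k + 1) hh₀m.enorm).trans_eq ?_
      rw [eLpNorm_enorm]
    calc _ ≤ _ := eLpNorm_mono_enorm hpt
      _ ≤ (eLpNorm (∑ i ∈ Finset.range k, a i) p ρ + eLpNorm (∑ i ∈ Finset.range k, a i) p ρ)
          + eLpNorm (∑ i ∈ Finset.range (k + 1), b i) p ρ + (eLpNorm c p ρ + eLpNorm c p ρ) :=
        (eLpNorm_add_le ((hsa.add hsa).add hsb) (hcm.add hcm) hp').trans (add_le_add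
          ((eLpNorm_add_le (hsa.add hsa) hsb hp').trans
            (add_le_add (eLpNorm_add_le hsa hsa hp') le_rfl)) (eLpNorm_add_le hcm hcm hp'))
      _ ≤ _ := by
        rw [← two_mul, ← two_mul, mul_assoc 2 (M.weight ρ μ p q (k + 1) 0)]
        gcongr
  rw [initTerm]
  rcases le_total (eLpNorm (fun s => M.optValue s - v 0 s) (p * q') μ)
    (eLpNorm (fun s => v 0 s - M.bellman (π 1) (v 0) s) (p * q') μ) with h | h
  · rw [min_eq_left h]
    exact key _ ((boundedMeasurable_optValue M).sub hv0).measurable (Or.inl rfl)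
  · rw [min_eq_right h]
    exact key _ (hv0.sub (boundedMeasurable_bellman _ hv0)).measurable (Or.inr rfl)

end MDP

end

theorem mainTheorem6 {S A : Type*} [MeasurableSpace S] [MeasurableSpace A] [Finite A]
    [DiscreteMeasurableSpace A] (M : MDP S A)
    (ρ μ : Measure S) [IsProbabilityMeasure ρ] [IsProbabilityMeasure μ]
    (hac : ∀ (π : ℕ → M.Policy) (j : ℕ), M.stateLaw ρ π j ≪ μ)
    (p : ℝ≥0) (hp : 1 ≤ p) (q q' : ℝ≥0∞) (hq : q⁻¹ + q'⁻¹ = 1) :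
    (∀ m : ℕ∞, 1 ≤ m → ∀ (v : ℕ → S → ℝ) (π : ℕ → M.Policy) (ε ε' : ℕ → S → ℝ),
      M.IsAMPI m v π ε ε' → ∀ k : ℕ, 1 ≤ k →
        eLpNorm (M.loss (π k)) p ρ ≤
          2 * ∑ i ∈ Finset.Icc 1 (k - 1),
              M.weight ρ μ p q i 0 * eLpNorm (ε (k - i)) (p * q') μ
          + ∑ i ∈ Finset.range k,
              M.weight ρ μ p q i 0 * eLpNorm (ε' (k - i)) (p * q') μ
          + M.initTerm ρ μ p q q' (v 0) (π 1) k) ∧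
    (∀ m : ℕ, 1 ≤ m → ∀ (v : ℕ → S → ℝ) (π : ℕ → M.Policy) (ε ε' : ℕ → S → ℝ),
      M.IsCBMPI m v π ε ε' → ∀ k : ℕ, 1 ≤ k →
        eLpNorm (M.loss (π k)) p ρ ≤
          2 * ENNReal.ofReal (M.γ ^ m) * ∑ i ∈ Finset.Icc 1 (k - 2),
              M.weight ρ μ p q i m * eLpNorm (ε (k - i - 1)) (p * q') μ
          + ∑ i ∈ Finset.range k,
              M.weight ρ μ p q i 0 * eLpNorm (ε' (k - i)) (p * q') μ
          + M.initTerm ρ μ p q q' (v 0) (π 1) k) := by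
  have hIcc : ∀ (n : ℕ) (F : ℕ → ℝ≥0∞),
      ∑ i ∈ Finset.Icc 1 n, F i = ∑ i ∈ Finset.range n, F (1 + i) := fun n F => by
    rw [← Finset.Ico_succ_right_eq_Icc, Finset.sum_Ico_eq_sum_range]
    simp
  obtain ⟨s₀⟩ : Nonempty S := nonempty_of_isProbabilityMeasure ρ
  constructor
  · intro m hm v π ε ε' hA k hk
    have : Nonempty A := ⟨(π 0).1 s₀⟩
    obtain ⟨k, rfl⟩ := Nat.exists_eq_add_of_le' hk
    have hv : ∀ k, BoundedMeasurable (v k) := fun k => ⟨hA.measurable_v k, hA.bounded_v k⟩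
    have hε : ∀ k, Measurable (ε (k + 1)) := fun k => by
      have h := (hv (k + 1)).sub (MDP.boundedMeasurable_bellmanPow (π (k + 1)) m (hv k))
      convert h.measurable using 2 with s
      rw [hA.eval k s, add_sub_cancel_left]
    refine (hA.eLpNorm_loss_le hac hp hq hm hε k).trans ?_
    rw [hIcc, Nat.add_sub_cancel]
    gcongr with i hi
    obtain ⟨j, hj⟩ : ∃ j, k - i = j + 1 :=
      ⟨k - i - 1, by have := Finset.mem_range.1 hi; omega⟩
    rw [show k + 1 - (1 + i) = j + 1 by omega, hj]
    refine (MDP.eLpNorm_discTail_le hac hp hq (1 + i) (hε j).enorm).trans_eq ?_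
    rw [eLpNorm_enorm]
  · intro m hm v π ε ε' hC k hk
    have : Nonempty A := ⟨(π 0).1 s₀⟩
    obtain ⟨k, rfl⟩ := Nat.exists_eq_add_of_le' hk
    have hv : ∀ k, BoundedMeasurable (v k) := fun k => ⟨hC.measurable_v k, hC.bounded_v k⟩
    set w := M.exactValue m v π with hwdef
    have hw : ∀ k, BoundedMeasurable (w k) := MDP.boundedMeasurable_exactValue π hv
    have hε : ∀ k s, ε (k + 1) s = v (k + 1) s - w (k + 1) s := fun k s => by
      rw [hC.eval k s]
      simp [hwdef, MDP.exactValue]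
    have hεm : ∀ k, Measurable (ε (k + 1)) := fun k => by
      rw [funext (hε k)]
      exact ((hv _).sub (hw _)).measurable
    refine (hC.isAMPI_exactValue.eLpNorm_loss_le hac hp hq (by exact_mod_cast hm)
      (fun k => ((hw _).sub (MDP.boundedMeasurable_bellmanPow _ _ (hw _))).measurable) k).trans ?_
    rw [mul_assoc]
    refine add_le_add (add_le_add (mul_le_mul_right ?_ _) le_rfl) le_rfl
    rw [hIcc]
    cases k with
    | zero => simp
    | succ k =>
      -- The first evaluation starts from `v 0 = w 0` and has no error.
      rw [Finset.sum_range_succ, show k + 1 + 1 - 2 = k by omega, Finset.mul_sum]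
      have hlast : eLpNorm (M.discTail (1 + k) fun x => ‖w (k + 1 - k) x
          - M.bellmanPow (π (k + 1 - k)) m (w (k + 1 - k - 1)) x‖ₑ) p ρ = 0 := by
        have h0 : (fun x => ‖w 1 x - M.bellmanPow (π 1) m (w 0) x‖ₑ) = fun _ => 0 :=
          funext fun x => by simp [hwdef, MDP.exactValue]
        rw [show k + 1 - k = 1 by omega, h0]
        have : M.discTail (1 + k) (fun _ => 0) = 0 := funext fun x => by
          simp [MDP.discTail, MDP.iterate_discExp_zero]
        rw [this, eLpNorm_zero]
      rw [hlast, add_zero]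
      refine Finset.sum_le_sum fun i hi => ?_
      obtain ⟨j, hj⟩ : ∃ j, k - i = j + 1 :=
        ⟨k - i - 1, by have := Finset.mem_range.1 hi; omega⟩
      rw [show k + 1 - i = j + 2 by omega, show k + 1 + 1 - (1 + i) - 1 = j + 1 by omega,
        ← eLpNorm_enorm (ε (j + 1))]
      refine le_trans (eLpNorm_mono_enorm fun x => ?_)
        (MDP.eLpNorm_discTail_iterate_le hac hp hq (1 + i) m (hεm j).enorm)
      rw [enorm_eq_self, enorm_eq_self]
      refine MDP.discTail_mono (fun y => ?_) _ x
      simp only [hε]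
      exact MDP.enorm_iterate_bellman_sub_le (hv (j + 1)) (hw (j + 1)) m y
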